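/- Let $n,r,d,k$ be positive integers with $n\ge 2$, $k\mid r$, $k\mid d$ and $n\equiv 1\pmod d$. Definitions. A prepartition is a triple $(I,\pi,\gamma)$ with $I\subseteq[n]$ (the zero block), $\pi$ a partition of $[n]\setminus I$ into nonempty (nonzero) blocks, and $\gamma:[n]\setminus I\to\mathbb Z/r\mathbb Z$ a labelling. Two prepartitions are equivalent if they have the same zero block and the same nonzero blocks, and on each nonzero block their labellings differ by a translation by an element of $\mathbb Z/r\mathbb Z$. The Dowling lattice $Q_n(r)$ is the set of equivalence classes $\overline{(I,\pi,\gamma)}$, with $x\le y$ if $y$ is obtained from $x$ by a (possibly empty) sequence of merges; a merge either replaces $I$ by $I\cup B$ for a nonzero block $B$, which is deleted from $\pi$, or replaces two distinct nonzero blocks $(B,\gamma|_B),(C,\gamma|_C)$ by $B\cup C$ labelled by $\gamma|_B$ on $B$ and $\gamma|_C+g$ on $C$, for some $g\in\mathbb Z/r\mathbb Z$. Its minimum $\hat0$ has $I=\emptyset$ and all nonzero blocks singletons. Let $|\pi|$ be the number of nonzero blocks. Let $Q_n(r,d,k,\{1\})$ be the subposet of $Q_n(r)$ consisting of $\hat 0$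 and of all $\overline{(I,\pi,\gamma)}$ such that $|I|\neq 1$, every nonzero block $B$ has size divisible by $d$, and for every nonzero block $B$ the number $|\{a\in B:\gamma(a)\equiv j \pmod k\}|$ does not depend on $j$. A bounded poset $P$ admits a recursive atom ordering if its length is $1$, or if its length is greater than $1$ and its atoms can be ordered $a_1,\dots,a_t$ such that (i) for every $j$ the interval $[a_j,\hat1]$ admits a recursive atom ordering in which the atoms of $[a_j,\hat1]$ that belong to $[a_i,\hat1]$ for some $i<j$ come first; (ii) for all $i<j$, if $a_i,a_j<y$, then there are $m<j$ and an atom $z$ of $[a_j,\hat1]$ with $a_m<z\le y$. Proposition. $Q_n(r,d,k,\{1\})$ is a lattice, it is pure (all maximal chains have the same finite length), and it is bounded and admits a recursive atom ordering. Its rank function (the function that vanishes on minimal elements and increases by $1$ along every covering relation) is $$\operatorname{rk}\overline{(I,\pi,\gamma)}=\begin{cases}0,&\overline{(I,\pi,\gamma)}=\hat0,\\ \lfloor n/d\rfloor-|\pi|,&\text{otherwise.}\end{cases}$$ -/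

import Mathlib

/-! ### Posets: lattices, purity, rank functions, recursive atom orderings -/

/-- A partial order in which any two elements have a join and a meet. -/
def IsLatticeOrder (P : Type*) [PartialOrder P] : Prop :=
  ∀ x y : P, (∃ z, IsLUB {x, y} z) ∧ (∃ z, IsGLB {x, y} z)

/-- A poset is pure if all its maximal chains are finite and have the same length `m`,
that is, the same number `m + 1` of elements. -/
def IsPurePoset (P : Type*) [PartialOrder P] : Prop :=
  ∃ m : ℕ, ∀ c : Set P, IsMaxChain (· ≤ ·) c → c.encard = m + 1

/-- `ρ` is the rank function of `P`: it vanishes on minimal elements and increases by one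
along every covering relation. -/
def IsRankFunction {P : Type*} [PartialOrder P] (ρ : P → ℤ) : Prop :=
  (∀ x, IsMin x → ρ x = 0) ∧ ∀ x y, x ⋖ y → ρ y = ρ x + 1

/-- `IsRecAtomOrdering t x l`: the list `l` is a recursive atom ordering of the interval `[x, t]`.
The atoms of `[x, t]` are the covers of `x` below `t`, and `[x, t]` has length `1` exactly when
`x ⋖ t`. In the second constructor, `m j` is the ordering chosen for the atoms of `[a_j, t]`. -/
inductive IsRecAtomOrdering {P : Type*} [PartialOrder P] (t : P) : P → List P → Prop
  | length_one {x : P} (h : x ⋖ t) : IsRecAtomOrdering t x [t]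
  | length_gt_one {x : P} {l : List P} (hlt : x < t) (hcov : ¬ x ⋖ t)
      (nodup : l.Nodup) (mem_iff : ∀ a, a ∈ l ↔ x ⋖ a ∧ a ≤ t)
      (m : Fin l.length → List P)
      (rec_ordering : ∀ j, IsRecAtomOrdering t (l.get j) (m j))
      (come_first : ∀ j, (m j).Pairwise fun u v =>
        (∃ i < j, l.get i ≤ v) → ∃ i < j, l.get i ≤ u)
      (common_cover : ∀ i j, i < j → ∀ y ≤ t, l.get i < y → l.get j < y →
        ∃ k < j, ∃ z, l.get j ⋖ z ∧ l.get k < z ∧ z ≤ y) :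
      IsRecAtomOrdering t x l

/-- `P` is bounded and admits a recursive atom ordering. -/
def AdmitsRecAtomOrdering (P : Type*) [PartialOrder P] : Prop :=
  ∃ b t : P, IsBot b ∧ IsTop t ∧ ∃ l : List P, IsRecAtomOrdering t b l

/-! ### The Dowling lattice of the cyclic group `ℤ/rℤ` -/

/-- A prepartition `(I, π, γ)` of `[n]` labelled by `ℤ/rℤ`: the zero block `I`, a partition `π` of
the complement of `I` into nonempty blocks, and the labelling `γ`. The values of `label` on the
zero block carry no information (they are ignored by `Equivalent` below). -/
structure Prepartition (n r : ℕ) where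
  zero : Finset (Fin n)
  partition : Finpartition zeroᶜ
  label : Fin n → ZMod r

namespace Prepartition

variable {n r : ℕ}

/-- The set of nonzero blocks. -/
def blocks (p : Prepartition n r) : Finset (Finset (Fin n)) := p.partition.parts

/-- Equal zero blocks, the same nonzero blocks, and on each nonzero block the labellings differ by
translation by an element of `ℤ/rℤ`. -/
def Equivalent (p q : Prepartition n r) : Prop :=
  p.zero = q.zero ∧ p.blocks = q.blocks ∧
    ∀ B ∈ p.blocks, ∃ g : ZMod r, ∀ a ∈ B, q.label a = p.label a + g

instance setoid (n r : ℕ) : Setoid (Prepartition n r) where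
  r := Equivalent
  iseqv :=
    { refl := fun _ => ⟨rfl, rfl, fun _ _ => ⟨0, fun _ _ => (add_zero _).symm⟩⟩
      symm := by
        rintro p q ⟨h1, h2, h3⟩
        refine ⟨h1.symm, h2.symm, fun B hB => ?_⟩
        obtain ⟨g, hg⟩ := h3 B (h2 ▸ hB)
        exact ⟨-g, fun a ha => by rw [hg a ha, add_neg_cancel_right]⟩
      trans := by
        rintro p q s ⟨h1, h2, h3⟩ ⟨k1, k2, k3⟩
        refine ⟨h1.trans k1, h2.trans k2, fun B hB => ?_⟩
        obtain ⟨g, hg⟩ := h3 B hB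
        obtain ⟨g', hg'⟩ := k3 B (h2 ▸ hB)
        exact ⟨g + g', fun a ha => by rw [hg' a ha, hg a ha, add_assoc]⟩ }

/-- `q` arises from `p` by merging the zero block with a nonzero block `B`. -/
def MergeZero (p q : Prepartition n r) : Prop :=
  ∃ B ∈ p.blocks, q.zero = p.zero ∪ B ∧ q.blocks = p.blocks.erase B ∧
    ∀ a ∉ q.zero, q.label a = p.label a

/-- `q` arises from `p` by replacing two distinct nonzero blocks `B`, `C` by the union of `B` and
the translate of `C` by `g`. -/
def MergeNonzero (p q : Prepartition n r) : Prop :=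
  ∃ B ∈ p.blocks, ∃ C ∈ p.blocks, B ≠ C ∧ ∃ g : ZMod r,
    q.zero = p.zero ∧ q.blocks = insert (B ∪ C) ((p.blocks.erase B).erase C) ∧
    (∀ a ∈ C, q.label a = p.label a + g) ∧
    ∀ a ∉ q.zero, a ∉ C → q.label a = p.label a

theorem MergeZero.card_lt {p q : Prepartition n r} (h : p.MergeZero q) :
    q.blocks.card < p.blocks.card := by
  obtain ⟨B, hB, -, h, -⟩ := h
  rw [h]
  exact Finset.card_erase_lt_of_mem hB

theorem MergeNonzero.card_lt {p q : Prepartition n r} (h : p.MergeNonzero q) :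
    q.blocks.card < p.blocks.card := by
  obtain ⟨B, hB, C, hC, hne, g, -, h, -⟩ := h
  rw [h]
  have h1 : C ∈ p.blocks.erase B := Finset.mem_erase.2 ⟨hne.symm, hC⟩
  have h2 := Finset.card_erase_lt_of_mem h1
  have h3 := Finset.card_erase_lt_of_mem hB
  have h4 := Finset.card_insert_le (B ∪ C) ((p.blocks.erase B).erase C)
  omega

end Prepartition

/-- The underlying set of the Dowling lattice `Q_n(r)`: classes of prepartitions. -/
def Dowling (n r : ℕ) : Type := Quotient (Prepartition.setoid n r)

namespace Dowling

variable {n r : ℕ}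

/-- The class of a prepartition. -/
def mk (p : Prepartition n r) : Dowling n r := Quotient.mk (Prepartition.setoid n r) p

/-- The number `|π|` of nonzero blocks. -/
def numBlocks (x : Dowling n r) : ℕ :=
  Quotient.lift (fun p : Prepartition n r => p.blocks.card)
    (fun p q (h : p.Equivalent q) => congrArg Finset.card h.2.1) x

/-- `y` is obtained from `x` by merging two blocks of `x`. -/
def Merge (x y : Dowling n r) : Prop :=
  ∃ p q : Prepartition n r, mk p = x ∧ mk q = y ∧ (p.MergeZero q ∨ p.MergeNonzero q)

theorem Merge.numBlocks_lt {x y : Dowling n r} (h : Merge x y) :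
    y.numBlocks < x.numBlocks := by
  obtain ⟨p, q, rfl, rfl, h | h⟩ := h
  · exact h.card_lt
  · exact h.card_lt

theorem eq_or_lt_of_merges {x y : Dowling n r} (h : Relation.ReflTransGen Merge x y) :
    x = y ∨ y.numBlocks < x.numBlocks := by
  induction h with
  | refl => exact Or.inl rfl
  | tail _ hm ih =>
    right
    rcases ih with rfl | ih
    · exact hm.numBlocks_lt
    · exact hm.numBlocks_lt.trans ih

/-- `x ≤ y` if `y` is obtained from `x` by a (possibly empty) sequence of merges. -/
instance : PartialOrder (Dowling n r) where
  le := Relation.ReflTransGen Merge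
  le_refl _ := Relation.ReflTransGen.refl
  le_trans _ _ _ h h' := h.trans h'
  le_antisymm x y h h' := by
    rcases eq_or_lt_of_merges h with h | h
    · exact h
    · rcases eq_or_lt_of_merges h' with h' | h'
      · exact h'.symm
      · exact absurd h (not_lt.2 h'.le)

/-- The minimum `0̂` of `Q_n(r)`: empty zero block, and all nonzero blocks are singletons. -/
def zeroHat (n r : ℕ) : Dowling n r :=
  mk { zero := ∅, partition := ⊥, label := fun _ => 0 }

/-- `Q_n(r,d)`: the elements whose nonzero blocks all have length divisible by `d`,
together with `0̂`. -/
def divisible (n r d : ℕ) : Set (Dowling n r) :=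
  {x | x = zeroHat n r ∨ ∃ p, mk p = x ∧ ∀ B ∈ p.blocks, d ∣ B.card}

/-- `Q_n(r,d,k)`: the elements of `Q_n(r,d)` such that in each nonzero block the number of labels
congruent to `j` modulo `k` does not depend on `j`, together with `0̂`. -/
def evenlyColoured (n r d k : ℕ) : Set (Dowling n r) :=
  {x | x = zeroHat n r ∨ (x ∈ divisible n r d ∧ ∃ p, mk p = x ∧ ∀ B ∈ p.blocks, ∀ i j : ℕ,
    (B.filter fun a => (p.label a).val ≡ i [MOD k]).card =
      (B.filter fun a => (p.label a).val ≡ j [MOD k]).card)}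

/-- `Q_n(r,d,k,J)`: the elements of `Q_n(r,d,k)` such that the size of the zero block is not in
`J`, together with `0̂`. -/
def restricted (n r d k : ℕ) (J : Set ℕ) : Set (Dowling n r) :=
  {x | x = zeroHat n r ∨ (x ∈ evenlyColoured n r d k ∧ ∃ p, mk p = x ∧ p.zero.card ∉ J)}

end Dowling

/-! An element of `Dowling n r` is determined by the elementary conditions it satisfies (`Holds`):
"a lies in the zero block", and "a, b lie both in the zero block, or in one nonzero block with label
difference g". The order is inclusion of these sets of conditions (`le_iff_holds`), and the least
element above `x` satisfying one further condition is a single merge away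
(`exists_merge_of_not_holds`). This yields joins, and semimodularity with `numBlocks` dropping by
one (`exists_isLUB_of_steps`).

Divisibility and even colouring pass upwards (`Balanced.of_le`). If d ≥ 2, the zero block of a
balanced element has size ≡ 1 mod d, so excluding size 1 means size at least d + 1, which also
passes upwards: the poset is an upper set of the Dowling lattice with 0̂ adjoined. Splitting blocks
(`exists_split`) shows that its atoms have n/d - 1 blocks, whence the rank formula. If d = 1, then k
= 1 and only the condition on the zero block remains; joins and one-merge steps survive because a
singleton zero block can be turned into a nonzero block (`exists_zeroBlock_eq_empty`).

Where semimodularity holds, every atom ordering is recursive (`isRecAtomOrdering_of_semimodular`).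
For d = 1 this covers the whole poset; for d ≥ 2 only the atoms above 0̂ need care. They are sorted
lexicographically by `key`: small sum of the zero block, then large sum of squared block sums, then
small code of the labels. A descent on the key (`exists_isRecAtomOrdering_of_key`) reduces the claim
to this: of two distinct atoms below `y`, one can be improved inside `y` (`improvable_or`). Indeed
an atom that no exchange of two elements improves has a forced zero block, and its nonzero blocks
cut each colour class of each block of `y` into consecutive runs, so they are forced too
(`class_eq_iff`). Labels can then differ only inside the zero block of `y`, where relabelling is
free. -/

open Finset

/-! ### Prepartitions as labelled relations -/

namespace Prepartition

variable {n r : ℕ}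

/-- `a` and `b` lie in a common nonzero block, and the label of `b` is that of `a` plus `g`. -/
def Rel (p : Prepartition n r) (a b : Fin n) (g : ZMod r) : Prop :=
  (∃ B ∈ p.blocks, a ∈ B ∧ b ∈ B) ∧ p.label b = p.label a + g

theorem Equivalent.rel_iff {p q : Prepartition n r} (h : p.Equivalent q) (a b : Fin n)
    (g : ZMod r) : p.Rel a b g ↔ q.Rel a b g := by
  obtain ⟨-, h2, h3⟩ := h
  unfold Rel
  rw [← h2]
  refine and_congr_right ?_
  rintro ⟨B, hB, ha, hb⟩
  obtain ⟨s, hs⟩ := h3 B hB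
  rw [hs a ha, hs b hb, add_right_comm, add_left_inj]

theorem mem_block_iff {p : Prepartition n r} {a : Fin n} :
    (∃ B ∈ p.blocks, a ∈ B) ↔ a ∉ p.zero := by
  constructor
  · rintro ⟨B, hB, ha⟩
    exact mem_compl.1 (p.partition.subset hB ha)
  · intro ha
    obtain ⟨B, hB, h⟩ := p.partition.exists_mem (mem_compl.2 ha)
    exact ⟨B, hB, h⟩

theorem block_unique {p : Prepartition n r} {a : Fin n} {B C : Finset (Fin n)}
    (hB : B ∈ p.blocks) (hC : C ∈ p.blocks) (haB : a ∈ B) (haC : a ∈ C) : B = C :=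
  p.partition.eq_of_mem_parts hB hC haB haC

theorem notMem_zero {p : Prepartition n r} {a : Fin n} {B : Finset (Fin n)}
    (hB : B ∈ p.blocks) (ha : a ∈ B) : a ∉ p.zero :=
  mem_block_iff.1 ⟨B, hB, ha⟩

theorem block_nonempty {p : Prepartition n r} {B : Finset (Fin n)}
    (hB : B ∈ p.blocks) : B.Nonempty :=
  p.partition.nonempty_of_mem_parts hB

/-- The block of `a` consists of the `b` related to `a` by some `g`, and these `g` are the label
differences. -/
theorem equivalent_of_rel {p q : Prepartition n r} (hz : p.zero = q.zero)
    (h : ∀ a b g, p.Rel a b g ↔ q.Rel a b g) : p.Equivalent q := by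
  have key : ∀ {p q : Prepartition n r}, (∀ a b g, p.Rel a b g ↔ q.Rel a b g) →
      p.zero = q.zero → ∀ B ∈ p.blocks, B ∈ q.blocks := by
    intro p q h hz B hB
    obtain ⟨a, ha⟩ := block_nonempty hB
    obtain ⟨C, hC, haC⟩ := mem_block_iff.2 (hz ▸ notMem_zero hB ha : a ∉ q.zero)
    have : B = C := by
      ext b
      constructor
      · intro hb
        obtain ⟨⟨D, hD, haD, hbD⟩, -⟩ :=
          (h a b (p.label b - p.label a)).1 ⟨⟨B, hB, ha, hb⟩, by abel⟩
        rwa [block_unique hC hD haC haD]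
      · intro hb
        obtain ⟨⟨D, hD, haD, hbD⟩, -⟩ :=
          (h a b (q.label b - q.label a)).2 ⟨⟨C, hC, haC, hb⟩, by abel⟩
        rwa [block_unique hB hD ha haD]
    rwa [this]
  refine ⟨hz, ?_, ?_⟩
  · ext B
    exact ⟨key h hz B, key (fun a b g => (h a b g).symm) hz.symm B⟩
  · intro B hB
    obtain ⟨a, ha⟩ := block_nonempty hB
    refine ⟨q.label a - p.label a, fun b hb => ?_⟩
    have := ((h a b (p.label b - p.label a)).1 ⟨⟨B, hB, ha, hb⟩, by abel⟩).2
    rw [this]; abel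

end Prepartition

/-! ### Elements of the Dowling lattice: relations, fibre form, elementary conditions -/

namespace Dowling

variable {n r : ℕ}

/-- The zero block of an element of the Dowling lattice. -/
def zeroBlock (x : Dowling n r) : Finset (Fin n) :=
  Quotient.lift (fun p : Prepartition n r => p.zero)
    (fun p q (h : p.Equivalent q) => h.1) x

/-- `a` and `b` lie in a common nonzero block of `x`, on which their labels differ by `g`. -/
def Rel (x : Dowling n r) (a b : Fin n) (g : ZMod r) : Prop :=
  Quotient.lift (fun p : Prepartition n r => p.Rel a b g)
    (fun p q (h : p.Equivalent q) => propext (h.rel_iff a b g)) x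

@[simp] theorem zeroBlock_mk (p : Prepartition n r) : (mk p).zeroBlock = p.zero := rfl
@[simp] theorem rel_mk (p : Prepartition n r) (a b : Fin n) (g : ZMod r) :
    (mk p).Rel a b g ↔ p.Rel a b g := Iff.rfl
@[simp] theorem numBlocks_mk (p : Prepartition n r) : (mk p).numBlocks = p.blocks.card := rfl

theorem exists_mk (x : Dowling n r) : ∃ p, mk p = x := Quotient.exists_rep x

theorem mk_eq_mk {p q : Prepartition n r} : mk p = mk q ↔ p.Equivalent q := Quotient.eq

theorem ext_rel {x y : Dowling n r} (hz : x.zeroBlock = y.zeroBlock)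
    (h : ∀ a b g, x.Rel a b g ↔ y.Rel a b g) : x = y := by
  obtain ⟨p, rfl⟩ := exists_mk x
  obtain ⟨q, rfl⟩ := exists_mk y
  exact mk_eq_mk.2 (Prepartition.equivalent_of_rel hz h)

section OfMap

variable {κ : Type}

open Classical in
/-- The prepartition with zero block `I` whose nonzero blocks are the fibres of `c` outside `I`. -/
noncomputable def preOfMap (I : Finset (Fin n)) (c : Fin n → κ) (γ : Fin n → ZMod r) :
    Prepartition n r where
  zero := I
  partition := Finpartition.ofSetSetoid (Setoid.ker c) Iᶜ
  label := γ

/-- The element of the Dowling lattice with zero block `I` whose nonzero blocks are the fibres of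
`c` outside `I`, labelled by `γ`. -/
noncomputable def ofMap (I : Finset (Fin n)) (c : Fin n → κ) (γ : Fin n → ZMod r) :
    Dowling n r := mk (preOfMap I c γ)

open Classical in
/-- The fibre of `c` over `i`, outside `I`. -/
noncomputable def fibre (I : Finset (Fin n)) (c : Fin n → κ) (i : κ) : Finset (Fin n) :=
  univ.filter fun a => a ∉ I ∧ c a = i

@[simp] theorem mem_fibre {I : Finset (Fin n)} {c : Fin n → κ} {i : κ} {a : Fin n} :
    a ∈ fibre I c i ↔ a ∉ I ∧ c a = i := by simp [fibre]

theorem mem_blocks_preOfMap {I : Finset (Fin n)} {c : Fin n → κ} {γ : Fin n → ZMod r}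
    {B : Finset (Fin n)} :
    B ∈ (preOfMap I c γ).blocks ↔ ∃ a ∉ I, B = fibre I c (c a) := by
  classical
  simp only [Prepartition.blocks, preOfMap, Finpartition.ofSetSetoid_parts, mem_image, mem_compl]
  refine exists_congr fun a => and_congr_right fun _ => ?_
  have : fibre I c (c a) = {b ∈ Iᶜ | (Setoid.ker c) a b} := by
    ext b
    simp [Setoid.ker_def, eq_comm]
  rw [this, eq_comm]

theorem fibre_mem_blocks {I : Finset (Fin n)} {c : Fin n → κ} {γ : Fin n → ZMod r} {a : Fin n}
    (ha : a ∉ I) : fibre I c (c a) ∈ (preOfMap I c γ).blocks :=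
  mem_blocks_preOfMap.2 ⟨a, ha, rfl⟩

@[simp] theorem zeroBlock_ofMap (I : Finset (Fin n)) (c : Fin n → κ) (γ : Fin n → ZMod r) :
    (ofMap I c γ).zeroBlock = I := rfl

@[simp] theorem rel_ofMap {I : Finset (Fin n)} {c : Fin n → κ} {γ : Fin n → ZMod r}
    {a b : Fin n} {g : ZMod r} :
    (ofMap I c γ).Rel a b g ↔ a ∉ I ∧ b ∉ I ∧ c a = c b ∧ γ b = γ a + g := by
  simp only [ofMap, rel_mk, Prepartition.Rel, mem_blocks_preOfMap]
  constructor
  · rintro ⟨⟨_, ⟨u, -, rfl⟩, ha, hb⟩, h⟩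
    rw [mem_fibre] at ha hb
    exact ⟨ha.1, hb.1, ha.2.trans hb.2.symm, h⟩
  · rintro ⟨ha, hb, h, h'⟩
    exact ⟨⟨_, ⟨a, ha, rfl⟩, mem_fibre.2 ⟨ha, rfl⟩, mem_fibre.2 ⟨hb, h.symm⟩⟩, h'⟩

theorem blocks_preOfMap [DecidableEq κ] (I : Finset (Fin n)) (c : Fin n → κ)
    (γ : Fin n → ZMod r) :
    (preOfMap I c γ).blocks = (Iᶜ.image c).image (fibre I c) := by
  ext B
  simp only [mem_blocks_preOfMap, mem_image, mem_compl]
  constructor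
  · rintro ⟨a, ha, rfl⟩
    exact ⟨c a, ⟨a, ha, rfl⟩, rfl⟩
  · rintro ⟨_, ⟨a, ha, rfl⟩, rfl⟩
    exact ⟨a, ha, rfl⟩

theorem numBlocks_ofMap [DecidableEq κ] (I : Finset (Fin n)) (c : Fin n → κ)
    (γ : Fin n → ZMod r) : (ofMap I c γ).numBlocks = (Iᶜ.image c).card := by
  rw [ofMap, numBlocks_mk, blocks_preOfMap, card_image_of_injOn]
  intro i hi j hj h
  obtain ⟨a, ha, rfl⟩ := mem_image.1 (mem_coe.1 hi)
  have : a ∈ fibre I c j := h ▸ mem_fibre.2 ⟨mem_compl.1 ha, rfl⟩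
  exact (mem_fibre.1 this).2

theorem mk_eq_ofMap (p : Prepartition n r) :
    mk p = ofMap p.zero p.partition.part p.label := by
  refine ext_rel rfl fun a b g => ?_
  rw [rel_mk, rel_ofMap, Prepartition.Rel]
  constructor
  · rintro ⟨⟨B, hB, ha, hb⟩, h⟩
    refine ⟨Prepartition.notMem_zero hB ha, Prepartition.notMem_zero hB hb, ?_, h⟩
    rw [p.partition.part_eq_of_mem hB ha, p.partition.part_eq_of_mem hB hb]
  · rintro ⟨ha, hb, h, h'⟩
    refine ⟨⟨_, p.partition.part_mem.2 (mem_compl.2 ha), ?_, ?_⟩, h'⟩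
    · exact p.partition.mem_part_self.2 (mem_compl.2 ha)
    · rw [h]; exact p.partition.mem_part_self.2 (mem_compl.2 hb)

theorem exists_ofMap (x : Dowling n r) :
    ∃ (I : Finset (Fin n)) (c : Fin n → Finset (Fin n)) (γ : Fin n → ZMod r),
      x = ofMap I c γ := by
  obtain ⟨p, rfl⟩ := exists_mk x
  exact ⟨_, _, _, mk_eq_ofMap p⟩

/-- Only the fibres outside `I` and the label differences within a fibre matter, so class maps with
values in different types can be compared. -/
theorem ofMap_congr {κ' : Type} {I : Finset (Fin n)} {c : Fin n → κ} {c' : Fin n → κ'}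
    {γ γ' : Fin n → ZMod r}
    (hc : ∀ a ∉ I, ∀ b ∉ I, (c a = c b ↔ c' a = c' b))
    (hγ : ∀ a ∉ I, ∀ b ∉ I, c a = c b → γ b - γ a = γ' b - γ' a) :
    ofMap I c γ = ofMap I c' γ' := by
  refine ext_rel rfl fun a b g => ?_
  rw [rel_ofMap, rel_ofMap]
  refine and_congr_right fun ha => and_congr_right fun hb => ?_
  rw [← hc a ha b hb]
  refine and_congr_right fun h => ?_
  rw [← sub_eq_iff_eq_add', ← sub_eq_iff_eq_add', hγ a ha b hb h]

end OfMap

/-- The elementary conditions on an element of the Dowling lattice: `inl a` says that `a` is in the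
zero block, `inr (a, b, g)` that `a` and `b` are both in the zero block or in the same nonzero
block with labels differing by `g`. -/
def Holds (x : Dowling n r) : Fin n ⊕ (Fin n × Fin n × ZMod r) → Prop
  | Sum.inl a => a ∈ x.zeroBlock
  | Sum.inr (a, b, g) => (a ∈ x.zeroBlock ∧ b ∈ x.zeroBlock) ∨ x.Rel a b g

@[simp] theorem holds_inl {x : Dowling n r} {a : Fin n} :
    x.Holds (Sum.inl a) ↔ a ∈ x.zeroBlock := Iff.rfl
@[simp] theorem holds_inr {x : Dowling n r} {a b : Fin n} {g : ZMod r} :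
    x.Holds (Sum.inr (a, b, g)) ↔ (a ∈ x.zeroBlock ∧ b ∈ x.zeroBlock) ∨ x.Rel a b g := Iff.rfl

theorem Rel.notMem_left {x : Dowling n r} {a b : Fin n} {g : ZMod r} (h : x.Rel a b g) :
    a ∉ x.zeroBlock := by
  obtain ⟨I, c, γ, rfl⟩ := exists_ofMap x
  exact (rel_ofMap.1 h).1

theorem Rel.notMem_right {x : Dowling n r} {a b : Fin n} {g : ZMod r} (h : x.Rel a b g) :
    b ∉ x.zeroBlock := by
  obtain ⟨I, c, γ, rfl⟩ := exists_ofMap x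
  exact (rel_ofMap.1 h).2.1

theorem Rel.eq {x : Dowling n r} {a b : Fin n} {g g' : ZMod r} (h : x.Rel a b g)
    (h' : x.Rel a b g') : g = g' := by
  obtain ⟨I, c, γ, rfl⟩ := exists_ofMap x
  exact add_left_cancel ((rel_ofMap.1 h).2.2.2.symm.trans (rel_ofMap.1 h').2.2.2)

theorem Rel.symm {x : Dowling n r} {a b : Fin n} {g : ZMod r} (h : x.Rel a b g) :
    x.Rel b a (-g) := by
  obtain ⟨I, c, γ, rfl⟩ := exists_ofMap x
  obtain ⟨h1, h2, h3, h4⟩ := rel_ofMap.1 h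
  exact rel_ofMap.2 ⟨h2, h1, h3.symm, by rw [h4]; abel⟩

theorem Rel.trans {x : Dowling n r} {a b c : Fin n} {g g' : ZMod r} (h : x.Rel a b g)
    (h' : x.Rel b c g') : x.Rel a c (g + g') := by
  obtain ⟨I, c, γ, rfl⟩ := exists_ofMap x
  obtain ⟨h1, h2, h3, h4⟩ := rel_ofMap.1 h
  obtain ⟨k1, k2, k3, k4⟩ := rel_ofMap.1 h'
  exact rel_ofMap.2 ⟨h1, k2, h3.trans k3, by rw [k4, h4, add_assoc]⟩

theorem ext_holds {x y : Dowling n r} (h : ∀ e, x.Holds e ↔ y.Holds e) : x = y := by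
  have hz : x.zeroBlock = y.zeroBlock := by
    ext a
    exact h (Sum.inl a)
  refine ext_rel hz fun a b g => ?_
  have := h (Sum.inr (a, b, g))
  rw [holds_inr, holds_inr, hz] at this
  constructor
  · intro hr
    rcases this.1 (Or.inr hr) with h | h
    · exact absurd (hz ▸ h.1) hr.notMem_left
    · exact h
  · intro hr
    rcases this.2 (Or.inr hr) with h | h
    · exact absurd h.1 hr.notMem_left
    · exact h

/-- The alternative "both in the zero block" in `Holds` is what lets a pair condition survive a
merge into the zero block. -/
theorem Merge.holds {x y : Dowling n r} (h : Merge x y)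
    (e : Fin n ⊕ (Fin n × Fin n × ZMod r)) (he : x.Holds e) : y.Holds e := by
  obtain ⟨p, q, rfl, rfl, ⟨B, hB, hz, hb, hl⟩ | ⟨B, hB, C, hC, hBC, g, hz, hb, hlC, hl⟩⟩ := h
  · rcases e with a | ⟨a, b, g⟩
    · simp only [holds_inl, zeroBlock_mk, hz] at he ⊢
      exact mem_union_left _ he
    · rcases he with ⟨h1, h2⟩ | ⟨⟨D, hD, ha, hb'⟩, h⟩
      · left
        simp only [zeroBlock_mk, hz] at h1 h2 ⊢
        exact ⟨mem_union_left _ h1, mem_union_left _ h2⟩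
      · by_cases hDB : D = B
        · left
          subst hDB
          simp only [zeroBlock_mk, hz]
          exact ⟨mem_union_right _ ha, mem_union_right _ hb'⟩
        · right
          have hDq : D ∈ q.blocks := hb ▸ mem_erase.2 ⟨hDB, hD⟩
          refine ⟨⟨D, hDq, ha, hb'⟩, ?_⟩
          rw [hl a (Prepartition.notMem_zero hDq ha), hl b (Prepartition.notMem_zero hDq hb'), h]
  · rcases e with a | ⟨a, b, g'⟩
    · simpa only [holds_inl, zeroBlock_mk, hz] using he
    · rcases he with h | ⟨⟨D, hD, ha, hb'⟩, h⟩
      · left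
        simpa only [zeroBlock_mk, hz] using h
      · right
        have hnz : ∀ u ∈ D, u ∉ q.zero := fun u hu => hz ▸ Prepartition.notMem_zero hD hu
        by_cases hDC : D = C
        · subst hDC
          refine ⟨⟨B ∪ D, hb ▸ mem_insert_self _ _, mem_union_right _ ha, mem_union_right _ hb'⟩, ?_⟩
          rw [hlC a ha, hlC b hb', h]; abel
        have hnC : ∀ u ∈ D, u ∉ C := fun u hu hu' => hDC (Prepartition.block_unique hD hC hu hu')
        refine ⟨?_, by rw [hl a (hnz a ha) (hnC a ha), hl b (hnz b hb') (hnC b hb'), h]⟩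
        by_cases hDB : D = B
        · subst hDB
          exact ⟨D ∪ C, hb ▸ mem_insert_self _ _, mem_union_left _ ha, mem_union_left _ hb'⟩
        · exact ⟨D, hb ▸ mem_insert_of_mem (mem_erase.2 ⟨hDC, mem_erase.2 ⟨hDB, hD⟩⟩), ha, hb'⟩

theorem holds_of_le {x y : Dowling n r} (h : x ≤ y)
    (e : Fin n ⊕ (Fin n × Fin n × ZMod r)) (he : x.Holds e) : y.Holds e := by
  change Relation.ReflTransGen Merge x y at h
  induction h with
  | refl => exact he
  | tail _ hm ih => exact hm.holds e ih

end Dowling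

/-! ### Merges in fibre form, and the order as inclusion of conditions -/

namespace Dowling

variable {n r : ℕ} {κ : Type}

theorem merge_zero_ofMap {I : Finset (Fin n)} {c : Fin n → κ} {γ : Fin n → ZMod r} {a : Fin n}
    (ha : a ∉ I) : Merge (ofMap I c γ) (ofMap (I ∪ fibre I c (c a)) c γ) := by
  refine ⟨_, _, rfl, rfl, Or.inl ⟨fibre I c (c a), fibre_mem_blocks ha, rfl, ?_, fun _ _ => rfl⟩⟩
  have key : ∀ b, b ∉ I → c b ≠ c a → fibre (I ∪ fibre I c (c a)) c (c b) = fibre I c (c b) := by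
    intro b hb hba
    ext u
    simp only [mem_fibre, mem_union, not_or, not_and]
    exact ⟨fun h => ⟨h.1.1, h.2⟩, fun h => ⟨⟨h.1, fun _ h' => hba (h.2.symm.trans h')⟩, h.2⟩⟩
  ext B
  rw [mem_erase, mem_blocks_preOfMap, mem_blocks_preOfMap]
  constructor
  · rintro ⟨b, hb, rfl⟩
    simp only [mem_fibre, mem_union, not_or, not_and] at hb
    rw [key b hb.1 (hb.2 hb.1)]
    refine ⟨fun h => ?_, b, hb.1, rfl⟩
    have : b ∈ fibre I c (c a) := h ▸ mem_fibre.2 ⟨hb.1, rfl⟩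
    exact hb.2 hb.1 (mem_fibre.1 this).2
  · rintro ⟨hne, b, hb, rfl⟩
    have hba : c b ≠ c a := fun h => hne (by rw [h])
    refine ⟨b, ?_, (key b hb hba).symm⟩
    simp only [mem_fibre, mem_union, not_or, not_and]
    exact ⟨hb, fun _ => hba⟩

theorem numBlocks_merge_zero {I : Finset (Fin n)} {c : Fin n → κ} {γ : Fin n → ZMod r}
    {a : Fin n} (ha : a ∉ I) :
    (ofMap (I ∪ fibre I c (c a)) c γ).numBlocks + 1 = (ofMap I c γ).numBlocks := by
  classical
  rw [numBlocks_ofMap, numBlocks_ofMap]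
  have : (I ∪ fibre I c (c a))ᶜ.image c = (Iᶜ.image c).erase (c a) := by
    ext i
    simp only [mem_image, mem_compl, mem_union, mem_fibre, not_or, not_and, mem_erase]
    constructor
    · rintro ⟨b, hb, rfl⟩
      exact ⟨hb.2 hb.1, b, hb.1, rfl⟩
    · rintro ⟨hne, b, hb, rfl⟩
      exact ⟨b, ⟨hb, fun _ => hne⟩, rfl⟩
  rw [this, card_erase_add_one]
  exact mem_image_of_mem _ (mem_compl.2 ha)

open Classical in
/-- The class map obtained by adding the fibre of `b` to that of `a`. -/
noncomputable def glue (c : Fin n → κ) (a b : Fin n) : Fin n → κ :=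
  fun u => if c u = c b then c a else c u

open Classical in
/-- The labelling obtained by translating the fibre of `b` so that the label of `b` becomes
the label of `a` plus `g`. -/
noncomputable def shift (c : Fin n → κ) (γ : Fin n → ZMod r) (a b : Fin n) (g : ZMod r) :
    Fin n → ZMod r :=
  fun u => if c u = c b then γ u + (γ a + g - γ b) else γ u

theorem shift_sub {c : Fin n → κ} {γ : Fin n → ZMod r} {a b u v : Fin n} {g : ZMod r}
    (h : c u = c v) : shift c γ a b g v - shift c γ a b g u = γ v - γ u := by
  unfold shift
  rw [h]
  split_ifs <;> abel

theorem glue_eq {c : Fin n → κ} {a b u v : Fin n} (h : c u = c v) :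
    glue c a b u = glue c a b v := by
  unfold glue
  rw [h]

theorem glue_eq_iff {c : Fin n → κ} {a b u v : Fin n} :
    glue c a b u = glue c a b v ↔
      c u = c v ∨ ((c u = c a ∨ c u = c b) ∧ (c v = c a ∨ c v = c b)) := by
  unfold glue
  by_cases hu : c u = c b <;> by_cases hv : c v = c b <;> simp [hu, hv]
  · tauto
  · exact fun h1 h2 => h1.trans h2.symm

theorem merge_nonzero_ofMap {I : Finset (Fin n)} {c : Fin n → κ} {γ : Fin n → ZMod r}
    {a b : Fin n} (ha : a ∉ I) (hb : b ∉ I) (hab : c a ≠ c b) (g : ZMod r) :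
    Merge (ofMap I c γ) (ofMap I (glue c a b) (shift c γ a b g)) := by
  refine ⟨_, _, rfl, rfl, Or.inr ⟨fibre I c (c a), fibre_mem_blocks ha, fibre I c (c b),
    fibre_mem_blocks hb, fun h => ?_, γ a + g - γ b, rfl, ?_, ?_, ?_⟩⟩
  · have : a ∈ fibre I c (c b) := h ▸ mem_fibre.2 ⟨ha, rfl⟩
    exact hab (mem_fibre.1 this).2
  · have key1 : ∀ u, (c u = c a ∨ c u = c b) →
        fibre I (glue c a b) (glue c a b u) = fibre I c (c a) ∪ fibre I c (c b) := by
      intro u hu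
      ext v
      rw [mem_union, mem_fibre, mem_fibre, mem_fibre, glue_eq_iff, ← and_or_left]
      refine and_congr_right fun _ => ⟨?_, fun h => Or.inr ⟨h, hu⟩⟩
      rintro (h | h)
      · rwa [h]
      · exact h.1
    have key2 : ∀ u, ¬ (c u = c a ∨ c u = c b) →
        fibre I (glue c a b) (glue c a b u) = fibre I c (c u) := by
      intro u hu
      ext v
      rw [mem_fibre, mem_fibre, glue_eq_iff]
      exact and_congr_right fun _ => ⟨fun h => h.resolve_right fun h' => hu h'.2, Or.inl⟩
    ext B
    rw [mem_insert, mem_erase, mem_erase, mem_blocks_preOfMap, mem_blocks_preOfMap]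
    constructor
    · rintro ⟨u, hu, rfl⟩
      by_cases h : c u = c a ∨ c u = c b
      · exact Or.inl (key1 u h)
      · right
        rw [key2 u h]
        have hmem : u ∈ fibre I c (c u) := mem_fibre.2 ⟨hu, rfl⟩
        refine ⟨fun h' => h (Or.inr ?_), fun h' => h (Or.inl ?_), u, hu, rfl⟩
        · exact (mem_fibre.1 (h' ▸ hmem)).2
        · exact (mem_fibre.1 (h' ▸ hmem)).2
    · rintro (rfl | ⟨h1, h2, u, hu, rfl⟩)
      · exact ⟨a, ha, (key1 a (Or.inl rfl)).symm⟩
      · refine ⟨u, hu, (key2 u ?_).symm⟩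
        rintro (h | h)
        · exact h2 (by rw [h])
        · exact h1 (by rw [h])
  · intro u hu
    exact if_pos (mem_fibre.1 hu).2
  · intro u hu hu'
    exact if_neg fun h => hu' (mem_fibre.2 ⟨hu, h⟩)

theorem numBlocks_merge_nonzero {I : Finset (Fin n)} {c : Fin n → κ} {γ γ' : Fin n → ZMod r}
    {a b : Fin n} (ha : a ∉ I) (hb : b ∉ I) (hab : c a ≠ c b) :
    (ofMap I (glue c a b) γ').numBlocks + 1 = (ofMap I c γ).numBlocks := by
  classical
  rw [numBlocks_ofMap, numBlocks_ofMap]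
  have : Iᶜ.image (glue c a b) = (Iᶜ.image c).erase (c b) := by
    ext i
    simp only [mem_image, mem_compl, mem_erase, glue]
    constructor
    · rintro ⟨u, hu, rfl⟩
      split_ifs with h
      · exact ⟨hab, a, ha, rfl⟩
      · exact ⟨h, u, hu, rfl⟩
    · rintro ⟨hne, u, hu, rfl⟩
      exact ⟨u, hu, if_neg hne⟩
  rw [this, card_erase_add_one]
  exact mem_image_of_mem _ (mem_compl.2 hb)

theorem mem_zeroBlock_of_rel {x y : Dowling n r} {a : Fin n}
    (hsub : ∀ e, x.Holds e → y.Holds e) (ha : a ∈ y.zeroBlock) {b : Fin n} {g : ZMod r}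
    (h : x.Rel a b g) : b ∈ y.zeroBlock := by
  rcases hsub (Sum.inr (a, b, g)) (Or.inr h) with h | h
  · exact h.2
  · exact absurd ha h.notMem_left

/-- The least element above `x` satisfying an elementary condition that fails in `x` arises from
`x` by a single merge. -/
theorem exists_merge_of_not_holds {x : Dowling n r} {e : Fin n ⊕ (Fin n × Fin n × ZMod r)}
    (he : ¬ x.Holds e) :
    ∃ z, Merge x z ∧ z.Holds e ∧ z.numBlocks + 1 = x.numBlocks ∧
      ∀ y : Dowling n r, (∀ e, x.Holds e → y.Holds e) → y.Holds e → ∀ e, z.Holds e → y.Holds e := by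
  obtain ⟨I, c, γ, rfl⟩ := exists_ofMap x
  -- Once `a` is in the zero block of `y`, so is its whole block; hence merging that block into the
  -- zero block is the least way to absorb `a`.
  have zstep : ∀ a ∉ I, ∃ z, Merge (ofMap I c γ) z ∧
      (∀ b, (b ∈ I ∨ c b = c a) → b ∈ z.zeroBlock) ∧
      z.numBlocks + 1 = (ofMap I c γ).numBlocks ∧
      ∀ y : Dowling n r, (∀ e, (ofMap I c γ).Holds e → y.Holds e) → a ∈ y.zeroBlock →
        ∀ e, z.Holds e → y.Holds e := by
    intro a ha
    refine ⟨_, merge_zero_ofMap ha, ?_, numBlocks_merge_zero ha, ?_⟩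
    · intro b hb
      rw [zeroBlock_ofMap, mem_union, mem_fibre]
      tauto
    · intro y hy hay
      have hz : ∀ b ∈ I ∪ fibre I c (c a), b ∈ y.zeroBlock := by
        intro b hb
        rcases mem_union.1 hb with hb | hb
        · exact hy (Sum.inl b) hb
        · obtain ⟨hb1, hb2⟩ := mem_fibre.1 hb
          exact mem_zeroBlock_of_rel hy hay
            (rel_ofMap.2 ⟨ha, hb1, hb2.symm, (add_sub_cancel (γ a) (γ b)).symm⟩)
      rintro (b | ⟨u, v, g⟩) h
      · exact hz b h
      · rcases h with h | h
        · exact Or.inl ⟨hz u h.1, hz v h.2⟩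
        · rw [rel_ofMap, mem_union, mem_union, not_or, not_or] at h
          exact hy (Sum.inr (u, v, g)) (Or.inr (rel_ofMap.2 ⟨h.1.1, h.2.1.1, h.2.2⟩))
  rcases e with a | ⟨a, b, g⟩
  · obtain ⟨z, h1, h2, h3, h4⟩ := zstep a he
    exact ⟨z, h1, h2 a (Or.inr rfl), h3, h4⟩
  · rw [holds_inr, rel_ofMap, zeroBlock_ofMap] at he
    by_cases ha : a ∈ I
    · have hb : b ∉ I := fun hb => he (Or.inl ⟨ha, hb⟩)
      obtain ⟨z, h1, h2, h3, h4⟩ := zstep b hb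
      refine ⟨z, h1, Or.inl ⟨h2 a (Or.inl ha), h2 b (Or.inr rfl)⟩, h3, fun y hy hye => h4 y hy ?_⟩
      rcases hye with h | h
      · exact h.2
      · exact absurd (hy (Sum.inl a) ha) h.notMem_left
    by_cases hb : b ∈ I
    · obtain ⟨z, h1, h2, h3, h4⟩ := zstep a ha
      refine ⟨z, h1, Or.inl ⟨h2 a (Or.inr rfl), h2 b (Or.inl hb)⟩, h3, fun y hy hye => h4 y hy ?_⟩
      rcases hye with h | h
      · exact h.1
      · exact absurd (hy (Sum.inl b) hb) h.notMem_right
    -- In one nonzero block with a label difference other than `g`: a nonzero block admits only one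
    -- difference, so the whole block has to enter the zero block.
    by_cases hab : c a = c b
    · obtain ⟨z, h1, h2, h3, h4⟩ := zstep a ha
      refine ⟨z, h1, Or.inl ⟨h2 a (Or.inr rfl), h2 b (Or.inr hab.symm)⟩, h3,
        fun y hy hye => h4 y hy ?_⟩
      rcases hye with h | h
      · exact h.1
      · have hx : (ofMap I c γ).Rel a b (γ b - γ a) :=
          rel_ofMap.2 ⟨ha, hb, hab, (add_sub_cancel (γ a) (γ b)).symm⟩
        rcases hy (Sum.inr (a, b, γ b - γ a)) (Or.inr hx) with h' | h'
        · exact h'.1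
        · exact absurd (Or.inr ⟨ha, hb, hab, by rw [h.eq h']; abel⟩) he
    · refine ⟨_, merge_nonzero_ofMap ha hb hab g, Or.inr (rel_ofMap.2 ⟨ha, hb, ?_, ?_⟩),
        numBlocks_merge_nonzero ha hb hab, ?_⟩
      · rw [glue_eq_iff]; tauto
      · unfold shift
        rw [if_pos rfl, if_neg hab]; abel
      · intro y hy hye
        have hI : ∀ u ∈ I, u ∈ y.zeroBlock := fun u hu => hy (Sum.inl u) hu
        -- the set of conditions satisfied by `y` is closed under composition
        have hsame : ∀ u ∉ I, ∀ v ∉ I, c u = c v → ∀ s : ZMod r, γ v = γ u + s →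
            y.Holds (Sum.inr (u, v, s)) := fun u hu v hv huv s hs =>
          hy (Sum.inr (u, v, s)) (Or.inr (rel_ofMap.2 ⟨hu, hv, huv, hs⟩))
        have htrans : ∀ u v w s t, y.Holds (Sum.inr (u, v, s)) → y.Holds (Sum.inr (v, w, t)) →
            y.Holds (Sum.inr (u, w, s + t)) := by
          rintro u v w s t (h | h) (h' | h')
          · exact Or.inl ⟨h.1, h'.2⟩
          · exact absurd h.2 h'.notMem_left
          · exact absurd h'.1 h.notMem_right
          · exact Or.inr (h.trans h')
        have hsymm : ∀ u v s, y.Holds (Sum.inr (u, v, s)) → y.Holds (Sum.inr (v, u, -s)) := by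
          rintro u v s (h | h)
          · exact Or.inl h.symm
          · exact Or.inr h.symm
        -- A pair across the two blocks is joined by the path u, a, b, v, along which differences
        -- add up.
        have hcross : ∀ u ∉ I, ∀ v ∉ I, c u = c a → c v = c b →
            y.Holds (Sum.inr (u, v, (γ a - γ u) + g + (γ v - γ b))) := by
          intro u hu v hv hua hvb
          exact htrans _ _ _ _ _ (htrans _ _ _ _ _
            (hsame u hu a ha hua _ (by abel)) hye) (hsame b hb v hv hvb.symm _ (by abel))
        rintro (u | ⟨u, v, s⟩) h
        · exact hI u h
        rcases h with h | h
        · exact Or.inl ⟨hI u h.1, hI v h.2⟩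
        obtain ⟨hu, hv, huv, hs⟩ := rel_ofMap.1 h
        by_cases hcu : c u = c v
        · refine hsame u hu v hv hcu s ?_
          have := shift_sub (γ := γ) (a := a) (b := b) (g := g) hcu
          rw [hs, add_sub_cancel_left] at this
          rw [this]; abel
        · rcases (glue_eq_iff.1 huv).resolve_left hcu with ⟨h1 | h1, h2 | h2⟩
          · exact absurd (h1.trans h2.symm) hcu
          · have hub : c u ≠ c b := fun h => hcu (h.trans h2.symm)
            convert hcross u hu v hv h1 h2 using 4
            unfold shift at hs
            rw [if_pos h2, if_neg hub] at hs
            rw [← sub_eq_iff_eq_add'] at hs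
            rw [← hs]; abel
          · have hvb : c v ≠ c b := fun h => hcu (h1.trans h.symm)
            convert hsymm _ _ _ (hcross v hv u hu h2 h1) using 4
            unfold shift at hs
            rw [if_pos h1, if_neg hvb] at hs
            rw [← sub_eq_iff_eq_add'] at hs
            rw [← hs]; abel
          · exact absurd (h1.trans h2.symm) hcu

/-- For the converse, a condition of `y` missing in `x` is imposed by one merge, which stays within
the conditions of `y` and lowers the number of blocks; induction on that number ends when the two
sets of conditions agree. -/
theorem le_iff_holds {x y : Dowling n r} : x ≤ y ↔ ∀ e, x.Holds e → y.Holds e := by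
  refine ⟨holds_of_le, fun h => ?_⟩
  induction hm : x.numBlocks using Nat.strong_induction_on generalizing x with
  | _ m ih =>
    by_cases hxy : ∃ e, y.Holds e ∧ ¬ x.Holds e
    · obtain ⟨e, hy, hx⟩ := hxy
      obtain ⟨z, h1, h2, h3, h4⟩ := exists_merge_of_not_holds hx
      exact (Relation.ReflTransGen.single h1 : x ≤ z).trans
        (ih z.numBlocks (by omega) (h4 y h hy) rfl)
    · push Not at hxy
      exact (ext_holds fun e => ⟨h e, hxy e⟩).le

theorem lt_of_merge {x y : Dowling n r} (h : Merge x y) : x < y :=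
  lt_of_le_of_ne (Relation.ReflTransGen.single h) fun h' => by
    have := h.numBlocks_lt
    rw [h'] at this
    exact lt_irrefl _ this

theorem numBlocks_lt_of_lt {x y : Dowling n r} (h : x < y) : y.numBlocks < x.numBlocks :=
  (eq_or_lt_of_merges h.le).resolve_left h.ne

theorem exists_holds_of_not_le {x y : Dowling n r} (h : ¬ x ≤ y) :
    ∃ e, x.Holds e ∧ ¬ y.Holds e := by
  rw [le_iff_holds] at h
  push Not at h
  exact h

theorem zeroBlock_mono {x y : Dowling n r} (h : x ≤ y) : x.zeroBlock ⊆ y.zeroBlock :=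
  fun a ha => le_iff_holds.1 h (Sum.inl a) ha

/-- The least element above `x` satisfying an elementary condition that fails in `x`. -/
theorem exists_least_of_not_holds {x : Dowling n r} {e : Fin n ⊕ (Fin n × Fin n × ZMod r)}
    (he : ¬ x.Holds e) :
    ∃ z, x < z ∧ z.Holds e ∧ z.numBlocks + 1 = x.numBlocks ∧
      ∀ y : Dowling n r, x ≤ y → y.Holds e → z ≤ y := by
  obtain ⟨z, h1, h2, h3, h4⟩ := exists_merge_of_not_holds he
  exact ⟨z, lt_of_merge h1, h2, h3, fun y hy hye => le_iff_holds.2 (h4 y (le_iff_holds.1 hy) hye)⟩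

theorem exists_least_of_finset (E : Finset (Fin n ⊕ (Fin n × Fin n × ZMod r)))
    (x : Dowling n r) :
    ∃ z, x ≤ z ∧ (∀ e ∈ E, z.Holds e) ∧
      ∀ y : Dowling n r, x ≤ y → (∀ e ∈ E, y.Holds e) → z ≤ y := by
  classical
  induction E using Finset.induction_on with
  | empty => exact ⟨x, le_rfl, by simp, fun y hy _ => hy⟩
  | insert e E _ ih =>
    obtain ⟨z, h1, h2, h3⟩ := ih
    by_cases he : z.Holds e
    · refine ⟨z, h1, ?_, fun y hy hE => h3 y hy fun e' he' => hE e' (mem_insert_of_mem he')⟩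
      intro e' he'
      rcases mem_insert.1 he' with rfl | he'
      · exact he
      · exact h2 e' he'
    · obtain ⟨w, k1, k2, -, k4⟩ := exists_least_of_not_holds he
      refine ⟨w, h1.trans k1.le, ?_, fun y hy hE =>
        k4 y (h3 y hy fun e' he' => hE e' (mem_insert_of_mem he')) (hE e (mem_insert_self _ _))⟩
      intro e' he'
      rcases mem_insert.1 he' with rfl | he'
      · exact k2
      · exact holds_of_le k1.le _ (h2 e' he')

/-- The join is the least element above `x` satisfying all conditions of `y`, of which there are
finitely many because r ≠ 0. -/
theorem exists_isLUB [NeZero r] (x y : Dowling n r) : ∃ z, IsLUB {x, y} z := by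
  obtain ⟨z, h1, h2, h3⟩ := exists_least_of_finset (Set.toFinite {e | y.Holds e}).toFinset x
  refine ⟨z, ?_, ?_⟩
  · rintro w (rfl | rfl)
    · exact h1
    · exact le_iff_holds.2 fun e he => h2 e (by simpa using he)
  · intro w hw
    refine h3 w (hw (by simp)) fun e he => ?_
    exact holds_of_le (hw (by simp : y ∈ ({x, y} : Set _))) e (by simpa using he)

end Dowling

/-! ### Divisible and evenly coloured blocks -/

namespace Dowling

variable {n r : ℕ} {κ κ' : Type}

theorem ofMap_le_iff {I : Finset (Fin n)} {c : Fin n → κ} {γ : Fin n → ZMod r}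
    {y : Dowling n r} :
    ofMap I c γ ≤ y ↔ I ⊆ y.zeroBlock ∧ ∀ a ∉ I, ∀ b ∉ I, c a = c b →
      (a ∈ y.zeroBlock ∧ b ∈ y.zeroBlock) ∨ y.Rel a b (γ b - γ a) := by
  rw [le_iff_holds]
  constructor
  · refine fun h => ⟨fun a ha => h (Sum.inl a) ha, fun a ha b hb hab => ?_⟩
    exact h (Sum.inr (a, b, γ b - γ a))
      (Or.inr (rel_ofMap.2 ⟨ha, hb, hab, (add_sub_cancel _ _).symm⟩))
  · rintro ⟨hI, h⟩ (a | ⟨a, b, g⟩) he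
    · exact hI he
    · rcases he with he | he
      · exact Or.inl ⟨hI he.1, hI he.2⟩
      · obtain ⟨ha, hb, hab, hg⟩ := rel_ofMap.1 he
        have := h a ha b hb hab
        rwa [hg, add_sub_cancel_left] at this

theorem ofMap_le_ofMap_iff {I J : Finset (Fin n)} {c : Fin n → κ} {e : Fin n → κ'}
    {γ δ : Fin n → ZMod r} :
    ofMap I c γ ≤ ofMap J e δ ↔ I ⊆ J ∧ ∀ a ∉ I, ∀ b ∉ I, c a = c b →
      (a ∈ J ∧ b ∈ J) ∨ (a ∉ J ∧ b ∉ J ∧ e a = e b ∧ δ b - δ a = γ b - γ a) := by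
  rw [ofMap_le_iff]
  simp only [rel_ofMap, zeroBlock_ofMap, sub_eq_iff_eq_add']

/-- Every fibre of `c` outside `I` has size divisible by `d`, and meets all colours of `χ` in the
same number of elements. -/
def Balanced {k : ℕ} (d : ℕ) (I : Finset (Fin n)) (c : Fin n → κ) (χ : Fin n → ZMod k) : Prop :=
  ∀ i, d ∣ (fibre I c i).card ∧ ∀ s t : ZMod k,
    ((fibre I c i).filter fun a => χ a = s).card = ((fibre I c i).filter fun a => χ a = t).card

variable {d k : ℕ}

theorem Balanced.card_filter_mul [NeZero k] {I : Finset (Fin n)} {c : Fin n → κ}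
    {χ : Fin n → ZMod k} (h : Balanced d I c χ) (i : κ) (s : ZMod k) :
    k * ((fibre I c i).filter fun a => χ a = s).card = (fibre I c i).card := by
  rw [card_eq_sum_card_fiberwise (s := fibre I c i) (f := χ) (t := univ) (by simp),
    sum_congr rfl fun t _ => (h i).2 t s]
  simp [ZMod.card]

/-- A nonzero block of the larger element is a disjoint union of blocks of the smaller one, on each
of which the labels are translated by a constant. Sizes add up, and a translation permutes the
colours. -/
theorem Balanced.of_le {hkr : k ∣ r} {I J : Finset (Fin n)} {c : Fin n → κ} {e : Fin n → κ'}
    {γ δ : Fin n → ZMod r} (h : Balanced d I c fun a => ZMod.castHom hkr (ZMod k) (γ a))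
    (hle : ofMap I c γ ≤ ofMap J e δ) :
    Balanced d J e fun a => ZMod.castHom hkr (ZMod k) (δ a) := by
  classical
  rw [ofMap_le_ofMap_iff] at hle
  obtain ⟨hIJ, hle⟩ := hle
  intro i
  set φ := ZMod.castHom hkr (ZMod k)
  set F := fibre J e i with hF
  have hmem : ∀ a ∈ F, a ∉ J ∧ e a = i := fun a ha => mem_fibre.1 ha
  have hfib : ∀ a ∈ F, F.filter (fun b => c b = c a) = fibre I c (c a) := by
    intro a ha
    obtain ⟨haJ, hai⟩ := hmem a ha
    ext b
    rw [mem_filter, mem_fibre, mem_fibre]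
    constructor
    · exact fun hb => ⟨fun h => hb.1.1 (hIJ h), hb.2⟩
    · rintro ⟨hb, hbc⟩
      rcases hle a (fun h => haJ (hIJ h)) b hb hbc.symm with h | h
      · exact absurd h.1 haJ
      · exact ⟨⟨h.2.1, h.2.2.1.symm.trans hai⟩, hbc⟩
  have hdiff : ∀ a ∈ F, ∀ b ∈ fibre I c (c a), φ (δ b) - φ (δ a) = φ (γ b) - φ (γ a) := by
    intro a ha b hb
    rw [mem_fibre] at hb
    obtain ⟨haJ, hai⟩ := hmem a ha
    rcases hle a (fun h => haJ (hIJ h)) b hb.1 hb.2.symm with h | h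
    · exact absurd h.1 haJ
    · rw [← map_sub, ← map_sub, h.2.2.2]
  constructor
  · rw [card_eq_sum_card_image c F]
    refine dvd_sum fun j hj => ?_
    obtain ⟨a, ha, rfl⟩ := mem_image.1 hj
    rw [hfib a ha]
    exact (h (c a)).1
  · have key : ∀ s a, a ∈ F → ((F.filter fun b => φ (δ b) = s).filter fun b => c b = c a).card =
        ((fibre I c (c a)).filter fun b => φ (γ b) = s - φ (δ a) + φ (γ a)).card := by
      intro s a ha
      rw [filter_comm, hfib a ha]
      congr 1
      refine filter_congr fun b hb => ?_
      have := hdiff a ha b hb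
      rw [sub_eq_sub_iff_add_eq_add] at this
      constructor
      · rintro rfl
        linear_combination -this
      · intro hb'
        linear_combination this + hb'
    intro s t
    rw [card_eq_sum_card_fiberwise (f := c) (t := F.image c)
        fun a ha => mem_image_of_mem c (mem_filter.1 ha).1,
      card_eq_sum_card_fiberwise (f := c) (t := F.image c)
        fun a ha => mem_image_of_mem c (mem_filter.1 ha).1]
    refine sum_congr rfl fun j hj => ?_
    obtain ⟨a, ha, rfl⟩ := mem_image.1 hj
    rw [key s a ha, key t a ha]
    exact (h (c a)).2 _ _

/-- The nonzero blocks have size divisible by `d` and are evenly coloured modulo `k`. -/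
def IsBalanced (d : ℕ) (hkr : k ∣ r) (x : Dowling n r) : Prop :=
  ∃ (I : Finset (Fin n)) (c : Fin n → Finset (Fin n)) (γ : Fin n → ZMod r),
    x = ofMap I c γ ∧ Balanced d I c fun a => ZMod.castHom hkr (ZMod k) (γ a)

/-- Independence of the representative: an equality is in particular an inequality, to which
`Balanced.of_le` applies. -/
theorem isBalanced_ofMap {hkr : k ∣ r} {I : Finset (Fin n)} {c : Fin n → κ} {γ : Fin n → ZMod r} :
    IsBalanced d hkr (ofMap I c γ) ↔ Balanced d I c fun a => ZMod.castHom hkr (ZMod k) (γ a) := by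
  constructor
  · rintro ⟨J, e, δ, h, hb⟩
    exact hb.of_le h.ge
  · intro h
    obtain ⟨J, e, δ, hJ⟩ := exists_ofMap (ofMap I c γ)
    exact ⟨J, e, δ, hJ, h.of_le hJ.le⟩

theorem IsBalanced.of_le {hkr : k ∣ r} {x y : Dowling n r} (h : IsBalanced d hkr x)
    (hxy : x ≤ y) : IsBalanced d hkr y := by
  obtain ⟨I, c, γ, rfl⟩ := exists_ofMap x
  obtain ⟨J, e, δ, rfl⟩ := exists_ofMap y
  exact isBalanced_ofMap.2 ((isBalanced_ofMap.1 h).of_le hxy)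

theorem isBalanced_mk [NeZero r] [NeZero k] {hkr : k ∣ r} {p : Prepartition n r} :
    IsBalanced d hkr (mk p) ↔ (∀ B ∈ p.blocks, d ∣ B.card) ∧
      ∀ B ∈ p.blocks, ∀ i j : ℕ, (B.filter fun a => (p.label a).val ≡ i [MOD k]).card =
        (B.filter fun a => (p.label a).val ≡ j [MOD k]).card := by
  have hcol : ∀ (B : Finset (Fin n)) (i : ℕ), (B.filter fun a => (p.label a).val ≡ i [MOD k]) =
      B.filter fun a => ZMod.castHom hkr (ZMod k) (p.label a) = (i : ZMod k) := by
    intro B i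
    refine filter_congr fun a _ => ?_
    rw [← ZMod.natCast_eq_natCast_iff, ZMod.castHom_apply, ZMod.cast_eq_val]
  have hblock : ∀ B ∈ p.blocks, ∃ i, B = fibre p.zero p.partition.part i := by
    intro B hB
    refine ⟨B, ?_⟩
    ext a
    rw [mem_fibre]
    constructor
    · exact fun ha => ⟨Prepartition.notMem_zero hB ha, p.partition.part_eq_of_mem hB ha⟩
    · rintro ⟨ha, rfl⟩
      exact p.partition.mem_part_self.2 (mem_compl.2 ha)
  have hfib : ∀ i, fibre p.zero p.partition.part i = ∅ ∨
      fibre p.zero p.partition.part i ∈ p.blocks := by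
    intro i
    rcases (fibre p.zero p.partition.part i).eq_empty_or_nonempty with h | ⟨a, ha⟩
    · exact Or.inl h
    · right
      obtain ⟨haz, rfl⟩ := mem_fibre.1 ha
      have hB := p.partition.part_mem.2 (mem_compl.2 haz)
      obtain ⟨j, hj⟩ := hblock _ hB
      have : p.partition.part a = j := by
        have : a ∈ fibre p.zero p.partition.part j := hj ▸ p.partition.mem_part_self.2
          (mem_compl.2 haz)
        exact (mem_fibre.1 this).2
      rw [← this] at hj
      rwa [← hj]
  rw [mk_eq_ofMap, isBalanced_ofMap]
  simp only [hcol]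
  constructor
  · refine fun h => ⟨fun B hB => ?_, fun B hB i j => ?_⟩ <;> obtain ⟨l, rfl⟩ := hblock B hB
    · exact (h l).1
    · exact (h l).2 _ _
  · rintro ⟨h1, h2⟩ i
    rcases hfib i with h | h
    · simp [h]
    · refine ⟨h1 _ h, fun s t => ?_⟩
      have := h2 _ h s.val t.val
      rwa [ZMod.natCast_zmod_val, ZMod.natCast_zmod_val] at this

/-- The definition allows different representatives for divisibility, colouring and zero block; all
three are invariants of the class. -/
theorem mem_restricted_iff [NeZero r] [NeZero k] (hkr : k ∣ r) {x : Dowling n r} :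
    x ∈ restricted n r d k {1} ↔
      x = zeroHat n r ∨ (x.zeroBlock.card ≠ 1 ∧ IsBalanced d hkr x) := by
  by_cases hx : x = zeroHat n r
  · simp [hx, restricted]
  simp only [restricted, evenlyColoured, divisible, Set.mem_ofPred_eq, hx, false_or,
    Set.mem_singleton_iff]
  obtain ⟨q, rfl⟩ := exists_mk x
  rw [isBalanced_mk]
  constructor
  · rintro ⟨⟨⟨p1, h1, h1'⟩, p2, h2, h2'⟩, p3, h3, h3'⟩
    rw [← h2] at h1 h3 ⊢
    refine ⟨?_, ?_⟩
    · rwa [zeroBlock_mk, ← (mk_eq_mk.1 h3).1]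
    · have : IsBalanced d hkr (mk p2) :=
        isBalanced_mk.2 ⟨(mk_eq_mk.1 h1).2.1 ▸ h1', h2'⟩
      rw [h2] at this
      exact isBalanced_mk.1 this
  · rintro ⟨h1, h2, h3⟩
    exact ⟨⟨⟨q, rfl, h2⟩, q, rfl, h3⟩, q, rfl, h1⟩

end Dowling

/-! ### Bounds, the restriction on the zero block, semimodularity -/

namespace Dowling

variable {n r : ℕ} {κ : Type} {d k : ℕ}

theorem zeroHat_eq_ofMap : zeroHat n r = ofMap ∅ id fun _ => 0 := by
  refine ext_rel rfl fun a b g => ?_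
  rw [rel_ofMap, zeroHat, rel_mk]
  simp only [Prepartition.Rel, Prepartition.blocks, Finpartition.mem_bot_iff]
  constructor
  · rintro ⟨⟨_, ⟨u, -, rfl⟩, ha, hb⟩, h⟩
    rw [mem_singleton] at ha hb
    exact ⟨notMem_empty _, notMem_empty _, ha.trans hb.symm, h⟩
  · rintro ⟨-, -, rfl, h⟩
    exact ⟨⟨{a}, ⟨a, by simp, rfl⟩, by simp, by simp⟩, h⟩

theorem zeroBlock_zeroHat : (zeroHat n r).zeroBlock = ∅ := rfl

theorem numBlocks_zeroHat : (zeroHat n r).numBlocks = n := by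
  classical
  rw [zeroHat_eq_ofMap, numBlocks_ofMap]
  simp

theorem holds_refl (x : Dowling n r) (a : Fin n) : x.Holds (Sum.inr (a, a, 0)) := by
  obtain ⟨I, c, γ, rfl⟩ := exists_ofMap x
  rw [holds_inr, rel_ofMap, zeroBlock_ofMap]
  by_cases ha : a ∈ I <;> simp [ha]

theorem zeroHat_le (x : Dowling n r) : zeroHat n r ≤ x := by
  rw [zeroHat_eq_ofMap, ofMap_le_iff]
  refine ⟨empty_subset _, ?_⟩
  rintro a - b - hab
  obtain rfl : a = b := hab
  rw [sub_self]
  exact holds_refl x a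

/-- The maximum of the Dowling lattice: all elements are in the zero block. -/
noncomputable def oneHat (n r : ℕ) : Dowling n r := ofMap univ (fun _ => ()) fun _ => 0

theorem le_oneHat (x : Dowling n r) : x ≤ oneHat n r := by
  obtain ⟨I, c, γ, rfl⟩ := exists_ofMap x
  rw [oneHat, ofMap_le_ofMap_iff]
  exact ⟨subset_univ _, fun a _ b _ _ => Or.inl ⟨mem_univ _, mem_univ _⟩⟩

theorem zeroBlock_oneHat : (oneHat n r).zeroBlock = univ := rfl

theorem numBlocks_oneHat : (oneHat n r).numBlocks = 0 := by
  classical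
  rw [oneHat, numBlocks_ofMap]
  simp

theorem card_eq_sum_fibre [DecidableEq κ] (I : Finset (Fin n)) (c : Fin n → κ) :
    n = I.card + ∑ i ∈ Iᶜ.image c, (fibre I c i).card := by
  have h1 : I.card + Iᶜ.card = n := by rw [card_add_card_compl, Fintype.card_fin]
  refine h1.symm.trans ?_
  rw [card_eq_sum_card_image c Iᶜ]
  congr 1
  refine sum_congr rfl fun i _ => ?_
  congr 1
  ext a
  simp

theorem fibre_nonempty {I : Finset (Fin n)} {c : Fin n → κ} [DecidableEq κ] {i : κ}
    (hi : i ∈ Iᶜ.image c) : (fibre I c i).Nonempty := by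
  obtain ⟨a, ha, rfl⟩ := mem_image.1 hi
  exact ⟨a, mem_fibre.2 ⟨mem_compl.1 ha, rfl⟩⟩

theorem IsBalanced.card_add_le {hkr : k ∣ r} {x : Dowling n r} (h : IsBalanced d hkr x) :
    x.zeroBlock.card + d * x.numBlocks ≤ n := by
  classical
  obtain ⟨I, c, γ, rfl, hb⟩ := h
  rw [numBlocks_ofMap, zeroBlock_ofMap]
  conv_rhs => rw [card_eq_sum_fibre I c]
  rw [add_le_add_iff_left, mul_comm, ← smul_eq_mul]
  exact card_nsmul_le_sum _ _ _ fun i hi =>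
    Nat.le_of_dvd (card_pos.2 (fibre_nonempty hi)) (hb i).1

theorem IsBalanced.exists_card_add {hkr : k ∣ r} {x : Dowling n r} (h : IsBalanced d hkr x) :
    ∃ q, x.zeroBlock.card + d * q = n := by
  classical
  obtain ⟨I, c, γ, rfl, hb⟩ := h
  obtain ⟨q, hq⟩ := dvd_sum fun i (_ : i ∈ Iᶜ.image c) => (hb i).1
  exact ⟨q, by rw [zeroBlock_ofMap, ← hq, ← card_eq_sum_fibre]⟩

/-- The elements of `Q_n(r,d,k,{1})`, apart from the minimum. -/
def IsGood (d : ℕ) (hkr : k ∣ r) (x : Dowling n r) : Prop :=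
  x.zeroBlock.card ≠ 1 ∧ IsBalanced d hkr x

/-- The nonzero blocks fill a multiple of d, so the zero block has size ≡ n ≡ 1 mod d. With 1
excluded, the next value is d + 1. -/
theorem IsGood.lt_card {hkr : k ∣ r} {x : Dowling n r} (h : IsGood d hkr x) (hd : 2 ≤ d)
    (hnd : n ≡ 1 [MOD d]) : d + 1 ≤ x.zeroBlock.card := by
  obtain ⟨q, hq⟩ := h.2.exists_card_add
  have h1 : x.zeroBlock.card ≡ 1 [MOD d] := by
    have h0 : (x.zeroBlock.card + d * q) % d = n % d := by rw [hq]
    rw [Nat.add_mul_mod_self_left] at h0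
    exact Nat.ModEq.trans h0 hnd
  have h2 := h.1
  by_contra hlt
  have h3 : x.zeroBlock.card % d = 1 := by
    rw [h1]; exact Nat.mod_eq_of_lt (by omega)
  rcases Nat.lt_or_ge x.zeroBlock.card d with h4 | h4
  · rw [Nat.mod_eq_of_lt h4] at h3
    exact h2 h3
  · have : x.zeroBlock.card = d := by omega
    rw [this, Nat.mod_self] at h3
    omega

theorem IsGood.of_le {hkr : k ∣ r} {x y : Dowling n r} (h : IsGood d hkr x) (hd : 2 ≤ d)
    (hnd : n ≡ 1 [MOD d]) (hxy : x ≤ y) : IsGood d hkr y := by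
  refine ⟨?_, h.2.of_le hxy⟩
  have h1 := h.lt_card hd hnd
  have h2 := card_le_card (zeroBlock_mono hxy)
  omega

theorem isBalanced_one {hkr : k ∣ r} (hkd : k ∣ d) (hd : d = 1) (x : Dowling n r) :
    IsBalanced d hkr x := by
  obtain ⟨I, c, γ, rfl⟩ := exists_ofMap x
  rw [isBalanced_ofMap]
  subst hd
  obtain rfl := Nat.dvd_one.1 hkd
  intro i
  refine ⟨one_dvd _, fun s t => ?_⟩
  rw [Subsingleton.elim s t]

/-- If the zero block of `z` is a singleton, it can be turned into a nonzero block. -/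
theorem exists_zeroBlock_eq_empty {z : Dowling n r} (hz : z.zeroBlock.card = 1) :
    ∃ z' : Dowling n r, z'.zeroBlock = ∅ ∧ (∀ u v g, z.Rel u v g → z'.Rel u v g) ∧
      ∀ x ≤ z, x.zeroBlock.card ≠ 1 → x ≤ z' := by
  classical
  obtain ⟨I, c, γ, rfl⟩ := exists_ofMap z
  obtain ⟨a, rfl⟩ := card_eq_one.1 hz
  have hrel : ∀ u v g, (ofMap {a} c γ).Rel u v g →
      (ofMap ∅ (fun u => if u = a then none else some (c u)) γ).Rel u v g := by
    intro u v g h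
    rw [rel_ofMap] at h ⊢
    obtain ⟨h1, h2, h3, h4⟩ := h
    rw [mem_singleton] at h1 h2
    simp [h1, h2, h3, h4]
  refine ⟨_, rfl, hrel, fun x hx hx1 => ?_⟩
  have hx0 : x.zeroBlock = ∅ := by
    rcases subset_singleton_iff.1 (zeroBlock_mono hx) with h | h
    · exact h
    · rw [h, card_singleton] at hx1
      exact absurd rfl hx1
  obtain ⟨I, c', γ', rfl⟩ := exists_ofMap x
  obtain rfl : I = ∅ := hx0
  rw [ofMap_le_iff] at hx ⊢
  refine ⟨empty_subset _, fun u hu v hv huv => ?_⟩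
  rcases hx.2 u hu v hv huv with h | h
  · rw [zeroBlock_ofMap, mem_singleton, mem_singleton] at h
    obtain ⟨rfl, rfl⟩ := h
    rw [sub_self]
    exact holds_refl _ _
  · exact Or.inr (hrel _ _ _ h)

/-- Otherwise freeing the single element of the zero block of the join would give an upper bound
with empty zero block, which is not above the join. -/
theorem card_zeroBlock_ne_one_of_isLUB {x y z : Dowling n r} (h : IsLUB {x, y} z)
    (hx : x.zeroBlock.card ≠ 1) (hy : y.zeroBlock.card ≠ 1) : z.zeroBlock.card ≠ 1 := by
  intro hz
  obtain ⟨z', h1, -, h3⟩ := exists_zeroBlock_eq_empty hz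
  have hle : z ≤ z' := by
    refine h.2 ?_
    rintro w (rfl | rfl)
    · exact h3 _ (h.1 (by simp)) hx
    · exact h3 _ (h.1 (by simp)) hy
  have := zeroBlock_mono hle
  rw [h1, subset_empty] at this
  simp [this] at hz

theorem exists_step {x y : Dowling n r} (hxy : x < y) :
    ∃ z, x < z ∧ z ≤ y ∧ z.numBlocks + 1 = x.numBlocks := by
  obtain ⟨e, he, he'⟩ := exists_holds_of_not_le hxy.not_ge
  obtain ⟨z, h1, -, h3, h4⟩ := exists_least_of_not_holds he'
  exact ⟨z, h1, h4 y hxy.le he, h3⟩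

/-- If a condition on two distinct elements holds in `y` but not in `x`, the least element
satisfying it cannot have a singleton zero block: freeing that element would preserve the condition.
If no such condition is missing, some `a` is missing from the zero block, and absorbing it draws
along any other element of the zero block of `y`. -/
theorem exists_step_card_ne_one {x y : Dowling n r} (hxy : x < y) (hx : x.zeroBlock.card ≠ 1)
    (hy : y.zeroBlock.card ≠ 1) :
    ∃ z, x < z ∧ z ≤ y ∧ z.numBlocks + 1 = x.numBlocks ∧ z.zeroBlock.card ≠ 1 := by
  by_cases hab : ∃ a b : Fin n, ∃ g, a ≠ b ∧ y.Holds (Sum.inr (a, b, g)) ∧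
      ¬ x.Holds (Sum.inr (a, b, g))
  · obtain ⟨a, b, g, hne, he, he'⟩ := hab
    obtain ⟨z, h1, h2, h3, h4⟩ := exists_least_of_not_holds he'
    refine ⟨z, h1, h4 y hxy.le he, h3, fun hz => ?_⟩
    obtain ⟨z', k1, k2, k3⟩ := exists_zeroBlock_eq_empty hz
    have hz' : z'.Holds (Sum.inr (a, b, g)) := by
      rcases h2 with h | h
      · obtain ⟨u, hu⟩ := card_eq_one.1 hz
        rw [hu, mem_singleton, mem_singleton] at h
        exact absurd (h.1.trans h.2.symm) hne
      · exact Or.inr (k2 _ _ _ h)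
    have := zeroBlock_mono (h4 z' (k3 x h1.le hx) hz')
    rw [k1, subset_empty] at this
    simp [this] at hz
  · push Not at hab
    have hz : ∃ a ∈ y.zeroBlock, a ∉ x.zeroBlock := by
      obtain ⟨e, he, he'⟩ := exists_holds_of_not_le hxy.not_ge
      rcases e with a | ⟨a, b, g⟩
      · exact ⟨a, he, he'⟩
      · by_cases hne : a = b
        · subst hne
          rcases he with h | h
          · exact ⟨a, h.1, fun h' => he' (Or.inl ⟨h', h'⟩)⟩
          · rcases holds_refl y a with h' | h'
            · exact absurd h'.1 h.notMem_left
            · rw [h.eq h'] at he'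
              exact absurd (holds_refl x a) he'
        · exact absurd (hab a b g hne he) he'
    obtain ⟨a, hay, hax⟩ := hz
    have hcard : 1 < y.zeroBlock.card := by
      have := card_pos.2 ⟨a, hay⟩
      omega
    obtain ⟨b, hb, hba⟩ := exists_mem_ne hcard a
    obtain ⟨z, h1, h2, h3, h4⟩ := exists_least_of_not_holds (x := x) (e := Sum.inl a) hax
    refine ⟨z, h1, h4 y hxy.le hay, h3, fun hz => ?_⟩
    have hbz : b ∈ z.zeroBlock := by
      rcases holds_of_le h1.le _ (hab a b 0 hba.symm (Or.inl ⟨hay, hb⟩)) with h | h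
      · exact h.2
      · exact absurd h2 h.notMem_left
    exact hba (card_le_one.1 hz.le b hbz a h2)

/-- Semimodularity of the Dowling lattice. -/
theorem exists_isLUB_of_steps {x u v : Dowling n r} (hxu : x ≤ u) (hxv : x < v)
    (hu : u.numBlocks + 1 = x.numBlocks) (hv : v.numBlocks + 1 = x.numBlocks) (huv : u ≠ v) :
    ∃ w, IsLUB {u, v} w ∧ u < w ∧ v < w ∧ w.numBlocks + 1 = u.numBlocks := by
  -- `v` is the least element above `x` satisfying `e`, and `u` does not satisfy `e`, as it would
  -- otherwise equal `v`. So the join of `u` and `v` is the least element above `u` satisfying `e`.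
  obtain ⟨e, he, he'⟩ := exists_holds_of_not_le hxv.not_ge
  obtain ⟨z, h1, h2, h3, h4⟩ := exists_least_of_not_holds he'
  obtain rfl : z = v := by
    refine (eq_or_lt_of_merges (h4 v hxv.le he)).resolve_right ?_
    omega
  have hue : ¬ u.Holds e := by
    intro hue
    rcases eq_or_lt_of_merges (h4 u hxu hue) with h | h
    · exact huv h.symm
    · omega
  obtain ⟨w, k1, k2, k3, k4⟩ := exists_least_of_not_holds hue
  have hzw : z ≤ w := h4 w (hxu.trans k1.le) k2
  refine ⟨w, ⟨?_, fun y hy => ?_⟩, k1, lt_of_le_of_ne hzw ?_, k3⟩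
  · rintro y (rfl | rfl)
    · exact k1.le
    · exact hzw
  · exact k4 y (hy (by simp)) (holds_of_le (hy (by simp : z ∈ ({u, z} : Set _))) e h2)
  · rintro rfl
    omega

end Dowling

/-! ### Splitting blocks downwards -/

namespace Dowling

variable {n r : ℕ} {κ : Type} {d k : ℕ}

/-- With d = kq, index `S` by `Fin q × ZMod k` and lift the second coordinate to a label. -/
theorem exists_even_labelling [NeZero k] (hkr : k ∣ r) (hkd : k ∣ d) {S : Finset (Fin n)}
    (hS : S.card = d) : ∃ lab : Fin n → ZMod r, ∀ s t : ZMod k,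
      (S.filter fun a => ZMod.castHom hkr (ZMod k) (lab a) = s).card =
        (S.filter fun a => ZMod.castHom hkr (ZMod k) (lab a) = t).card := by
  classical
  obtain ⟨q, hq⟩ := hkd
  have e : S ≃ Fin q × ZMod k := Fintype.equivOfCardEq (by
    rw [Fintype.card_coe, Fintype.card_prod, Fintype.card_fin, ZMod.card, hS, hq, mul_comm])
  let lab : Fin n → ZMod r := fun a => if h : a ∈ S then (((e ⟨a, h⟩).2.val : ℕ) : ZMod r) else 0
  have hlab : ∀ a (h : a ∈ S), ZMod.castHom hkr (ZMod k) (lab a) = (e ⟨a, h⟩).2 := by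
    intro a h
    simp only [lab, dif_pos h, map_natCast, ZMod.natCast_zmod_val]
  have key : ∀ s, (S.filter fun a => ZMod.castHom hkr (ZMod k) (lab a) = s).card = q := by
    intro s
    have : (S.filter fun a => ZMod.castHom hkr (ZMod k) (lab a) = s) =
        (univ : Finset (Fin q)).image fun i => (e.symm (i, s)).1 := by
      ext a
      rw [mem_filter, mem_image]
      constructor
      · rintro ⟨h, hs⟩
        rw [hlab a h] at hs
        refine ⟨(e ⟨a, h⟩).1, mem_univ _, ?_⟩
        rw [← hs]
        simp
      · rintro ⟨i, -, rfl⟩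
        refine ⟨(e.symm (i, s)).2, ?_⟩
        rw [hlab _ (e.symm (i, s)).2]
        simp
    rw [this, card_image_of_injective, card_univ, Fintype.card_fin]
    intro i j hij
    have := e.symm.injective (Subtype.ext hij)
    exact (Prod.ext_iff.1 this).1
  exact ⟨lab, fun s t => (key s).trans (key t).symm⟩

/-- Any d elements of the zero block form a new nonzero block with an even labelling; d + 1 < |I|
keeps the remaining zero block larger than a singleton. -/
theorem exists_split_zero [NeZero k] {hkr : k ∣ r} (hkd : k ∣ d) (hd : 2 ≤ d)
    {I : Finset (Fin n)} {c : Fin n → κ} {γ : Fin n → ZMod r}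
    (h : IsBalanced d hkr (ofMap I c γ)) (hI : d + 1 < I.card) :
    ∃ z, IsGood d hkr z ∧ z ≤ ofMap I c γ ∧ z.numBlocks = (ofMap I c γ).numBlocks + 1 := by
  classical
  obtain ⟨S, hSI, hS⟩ := exists_subset_card_eq (show d ≤ I.card by omega)
  obtain ⟨lab, hlab⟩ := exists_even_labelling hkr hkd hS
  rw [isBalanced_ofMap] at h
  set c' : Fin n → Option κ := fun u => if u ∈ S then none else some (c u) with hc'
  set γ' : Fin n → ZMod r := fun u => if u ∈ S then lab u else γ u with hγ'
  have hnone : fibre (I \ S) c' none = S := by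
    ext u
    by_cases hu : u ∈ S <;> simp [hc', hu]
  have hsome : ∀ i, fibre (I \ S) c' (some i) = fibre I c i := by
    intro i
    ext u
    by_cases hu : u ∈ S
    · simp [hc', hu, hSI hu]
    · simp [hc', hu]
  refine ⟨ofMap (I \ S) c' γ', ⟨?_, ?_⟩, ?_, ?_⟩
  · rw [zeroBlock_ofMap, card_sdiff_of_subset hSI, hS]
    omega
  · rw [isBalanced_ofMap]
    rintro (_ | i)
    · rw [hnone]
      refine ⟨hS ▸ dvd_rfl, fun s t => ?_⟩
      have : ∀ s : ZMod k, (S.filter fun a => ZMod.castHom hkr (ZMod k) (γ' a) = s) =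
          S.filter fun a => ZMod.castHom hkr (ZMod k) (lab a) = s := by
        intro s
        refine filter_congr fun a ha => ?_
        simp [hγ', ha]
      rw [this, this]
      exact hlab s t
    · rw [hsome]
      refine ⟨(h i).1, fun s t => ?_⟩
      have : ∀ s : ZMod k, ((fibre I c i).filter fun a => ZMod.castHom hkr (ZMod k) (γ' a) = s) =
          (fibre I c i).filter fun a => ZMod.castHom hkr (ZMod k) (γ a) = s := by
        intro s
        refine filter_congr fun a ha => ?_
        have : a ∉ S := fun h => (mem_fibre.1 ha).1 (hSI h)
        simp [hγ', this]
      rw [this, this]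
      exact (h i).2 s t
  · rw [ofMap_le_ofMap_iff]
    refine ⟨sdiff_subset, fun a ha b hb hab => ?_⟩
    by_cases haS : a ∈ S <;> by_cases hbS : b ∈ S
    · exact Or.inl ⟨hSI haS, hSI hbS⟩
    · simp [hc', haS, hbS] at hab
    · simp [hc', haS, hbS] at hab
    · right
      simp only [mem_sdiff, haS, hbS, not_false_eq_true, and_true] at ha hb
      simp only [hc', haS, hbS, if_false, Option.some.injEq] at hab
      simp [hγ', haS, hbS, ha, hb, hab]
  · rw [numBlocks_ofMap, numBlocks_ofMap]
    have : (I \ S)ᶜ.image c' = insert none ((Iᶜ.image c).image some) := by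
      ext i
      simp only [mem_image, mem_insert, mem_compl, mem_sdiff, not_and, not_not]
      constructor
      · rintro ⟨a, ha, rfl⟩
        by_cases haS : a ∈ S
        · simp [hc', haS]
        · right
          exact ⟨c a, ⟨a, fun h => haS (ha h), rfl⟩, by simp [hc', haS]⟩
      · rintro (rfl | ⟨_, ⟨a, ha, rfl⟩, rfl⟩)
        · obtain ⟨a, ha⟩ := card_pos.1 (show 0 < S.card by omega)
          exact ⟨a, fun _ => ha, by simp [hc', ha]⟩
        · have haS : a ∉ S := fun h => ha (hSI h)
          exact ⟨a, fun h => absurd h ha, by simp [hc', haS]⟩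
    rw [this, card_insert_of_notMem (by simp), card_image_of_injective _ (Option.some_injective _)]

/-- Split off d/k elements of each colour without changing labels; both parts stay evenly coloured.
-/
theorem exists_split_fibre [NeZero k] {hkr : k ∣ r} (hkd : k ∣ d) (hd : 2 ≤ d)
    {I : Finset (Fin n)} {c : Fin n → κ} {γ : Fin n → ZMod r}
    (h : IsGood d hkr (ofMap I c γ)) {i : κ} (hi : d < (fibre I c i).card) :
    ∃ z, IsGood d hkr z ∧ z ≤ ofMap I c γ ∧ z.numBlocks = (ofMap I c γ).numBlocks + 1 := by
  classical
  obtain ⟨hcard, hb⟩ := h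
  rw [isBalanced_ofMap] at hb
  obtain ⟨q, hq⟩ := hkd
  set χ : Fin n → ZMod k := fun a => ZMod.castHom hkr (ZMod k) (γ a) with hχ
  have hT : ∀ s, ∃ T ⊆ (fibre I c i).filter fun a => χ a = s, T.card = q := by
    intro s
    refine exists_subset_card_eq ?_
    have h1 := hb.card_filter_mul i s
    by_contra! h2
    have h3 := Nat.mul_le_mul_left k h2.le
    omega
  choose T hTsub hTcard using hT
  set S := univ.biUnion T with hSdef
  have hTmem : ∀ s, ∀ a ∈ T s, a ∈ fibre I c i ∧ χ a = s := fun s a ha =>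
    mem_filter.1 (hTsub s ha)
  have hSsub : S ⊆ fibre I c i := by
    intro a ha
    obtain ⟨s, -, hs⟩ := mem_biUnion.1 ha
    exact (hTmem s a hs).1
  have hSfil : ∀ s, (S.filter fun a => χ a = s) = T s := by
    intro s
    ext a
    rw [mem_filter]
    constructor
    · rintro ⟨ha, rfl⟩
      obtain ⟨t, -, ht⟩ := mem_biUnion.1 ha
      rwa [(hTmem t a ht).2]
    · exact fun ha => ⟨mem_biUnion.2 ⟨s, mem_univ _, ha⟩, (hTmem s a ha).2⟩
  have hScard : S.card = d := by
    rw [card_eq_sum_card_fiberwise (s := S) (f := χ) (t := univ) (by simp)]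
    simp only [hSfil, hTcard, sum_const, card_univ, ZMod.card, smul_eq_mul, hq]
  have hSI : ∀ a ∈ S, a ∉ I := fun a ha => (mem_fibre.1 (hSsub ha)).1
  have hSi : ∀ a ∈ S, c a = i := fun a ha => (mem_fibre.1 (hSsub ha)).2
  set c' : Fin n → κ × Prop := fun u => (c u, u ∈ S) with hc'
  have htrue : ∀ j, fibre I c' (j, True) = if j = i then S else ∅ := by
    intro j
    ext u
    split_ifs with hj
    · subst hj
      simp only [mem_fibre, hc', Prod.mk.injEq, eq_iff_iff, iff_true]
      exact ⟨fun h => h.2.2, fun h => ⟨hSI u h, hSi u h, h⟩⟩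
    · simp only [mem_fibre, hc', Prod.mk.injEq, eq_iff_iff, iff_true, notMem_empty, iff_false]
      exact fun h => hj (h.2.1.symm.trans (hSi u h.2.2))
  have hfalse : ∀ j, fibre I c' (j, False) = fibre I c j \ S := by
    intro j
    ext u
    simp [hc', and_assoc]
  have hdisj : ∀ j, j ≠ i → fibre I c j \ S = fibre I c j := by
    intro j hj
    refine sdiff_eq_self_of_disjoint (disjoint_left.2 fun a ha haS => hj ?_)
    exact (mem_fibre.1 ha).2.symm.trans (hSi a haS)
  refine ⟨ofMap I c' γ, ⟨hcard, ?_⟩, ?_, ?_⟩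
  · rw [isBalanced_ofMap]
    rintro ⟨j, p⟩
    by_cases hp : p
    · rw [eq_true hp, htrue]
      split_ifs
      · refine ⟨hScard ▸ dvd_rfl, fun s t => ?_⟩
        have := hSfil s
        have h2 := hSfil t
        simp only [hχ] at this h2
        rw [this, h2, hTcard, hTcard]
      · exact ⟨by simp, fun s t => by simp only [filter_empty]⟩
    · rw [eq_false hp, hfalse]
      by_cases hj : j = i
      · subst hj
        refine ⟨?_, fun s t => ?_⟩
        · rw [card_sdiff_of_subset hSsub, hScard]
          exact Nat.dvd_sub (hb j).1 dvd_rfl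
        · have : ∀ s : ZMod k, (((fibre I c j) \ S).filter fun a => χ a = s).card =
              ((fibre I c j).filter fun a => χ a = s).card - q := by
            intro s
            rw [← hTcard s, ← card_sdiff_of_subset (hTsub s), ← hSfil s]
            congr 1
            ext a
            simp only [mem_filter, mem_sdiff]
            tauto
          have hs := this s
          have ht := this t
          simp only [hχ] at hs ht
          rw [hs, ht, (hb j).2 s t]
      · rw [hdisj j hj]
        exact hb j
  · rw [ofMap_le_ofMap_iff]
    refine ⟨Subset.rfl, fun a ha b hb hab => Or.inr ⟨ha, hb, ?_, rfl⟩⟩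
    exact (Prod.ext_iff.1 hab).1
  · rw [numBlocks_ofMap, numBlocks_ofMap]
    have : Iᶜ.image c' = insert (i, True) ((Iᶜ.image c).image fun j => (j, False)) := by
      ext ⟨j, p⟩
      simp only [mem_insert, mem_image, mem_compl]
      constructor
      · rintro ⟨a, ha, hap⟩
        simp only [hc', Prod.mk.injEq] at hap
        obtain ⟨rfl, rfl⟩ := hap
        by_cases haS : a ∈ S
        · left
          simp [haS, hSi a haS]
        · right
          exact ⟨c a, ⟨a, ha, rfl⟩, by simp [haS]⟩
      · rintro (h | ⟨_, ⟨a, ha, rfl⟩, h⟩)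
        · obtain ⟨a, ha⟩ := card_pos.1 (show 0 < S.card by omega)
          exact ⟨a, hSI a ha, by simp [hc', ha, hSi a ha, h]⟩
        · have : ∃ b, b ∉ I ∧ c b = c a ∧ b ∉ S := by
            by_cases hai : c a = i
            · have : (fibre I c i \ S).Nonempty := by
                rw [← card_pos, card_sdiff_of_subset hSsub]
                omega
              obtain ⟨b, hb⟩ := this
              rw [mem_sdiff, mem_fibre] at hb
              exact ⟨b, hb.1.1, hb.1.2.trans hai.symm, hb.2⟩
            · exact ⟨a, ha, rfl, fun h => hai (hSi a h)⟩
          obtain ⟨b, hb1, hb2, hb3⟩ := this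
          exact ⟨b, hb1, by simp [hc', hb2, hb3, h]⟩
    rw [this, card_insert_of_notMem (by simp), card_image_of_injective]
    exact fun a b h => (Prod.ext_iff.1 h).1

/-- If the zero block has at most d + 1 elements and every nonzero block at most d, then n ≤ d|π| +
d + 1, contrary to `hlt`. -/
theorem exists_split [NeZero k] {hkr : k ∣ r} (hkd : k ∣ d) (hd : 2 ≤ d) {y : Dowling n r}
    (hy : IsGood d hkr y) (hlt : d * (y.numBlocks + 1) + 1 < n) :
    ∃ z, IsGood d hkr z ∧ z ≤ y ∧ z.numBlocks = y.numBlocks + 1 := by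
  classical
  obtain ⟨I, c, γ, rfl⟩ := exists_ofMap y
  by_cases hI : d + 1 < I.card
  · exact exists_split_zero hkd hd hy.2 hI
  by_cases hc : ∃ i, d < (fibre I c i).card
  · obtain ⟨i, hi⟩ := hc
    exact exists_split_fibre hkd hd hy hi
  push Not at hc
  exfalso
  have h1 := card_eq_sum_fibre I c
  have h2 : ∑ i ∈ Iᶜ.image c, (fibre I c i).card ≤ (Iᶜ.image c).card • d :=
    sum_le_card_nsmul _ _ _ fun i _ => hc i
  rw [smul_eq_mul, mul_comm] at h2
  rw [numBlocks_ofMap, mul_add, mul_one] at hlt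
  omega

theorem exists_le_of_isGood [NeZero k] {hkr : k ∣ r} (hkd : k ∣ d) (hd : 2 ≤ d)
    {y : Dowling n r} (hy : IsGood d hkr y) {m : ℕ} (hm : d * m + 1 < n) (hle : y.numBlocks ≤ m) :
    ∃ z, IsGood d hkr z ∧ z ≤ y ∧ z.numBlocks = m := by
  induction hj : m - y.numBlocks generalizing y with
  | zero => exact ⟨y, hy, le_rfl, by omega⟩
  | succ j ih =>
    have hlt : d * (y.numBlocks + 1) ≤ d * m := Nat.mul_le_mul_left d (by omega)
    obtain ⟨z, h1, h2, h3⟩ := exists_split hkd hd hy (by omega)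
    obtain ⟨w, k1, k2, k3⟩ := ih h1 (by omega) (by omega)
    exact ⟨w, k1, k2.trans h2, k3⟩

end Dowling

/-! ### Purity, lattices and atom orderings in finite posets -/

section Poset

variable {P : Type*} [PartialOrder P]

theorem covBy_of_rank_eq {ρ : P → ℤ} (hρ : StrictMono ρ) {x y : P} (hxy : x < y)
    (h : ρ y = ρ x + 1) : x ⋖ y := by
  refine ⟨hxy, fun z h1 h2 => ?_⟩
  have := hρ h1
  have := hρ h2
  omega

theorem rank_eq_of_covBy {ρ : P → ℤ}
    (hstep : ∀ x y : P, x < y → ∃ z, x < z ∧ z ≤ y ∧ ρ z = ρ x + 1) {x y : P} (h : x ⋖ y) :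
    ρ y = ρ x + 1 := by
  obtain ⟨z, h1, h2, h3⟩ := hstep x y h.lt
  rcases h2.eq_or_lt with rfl | h2
  · exact h3
  · exact absurd h2 (h.2 h1)

theorem isRankFunction_of_step {ρ : P → ℤ} {b : P} (hb : IsBot b) (hρb : ρ b = 0)
    (hstep : ∀ x y : P, x < y → ∃ z, x < z ∧ z ≤ y ∧ ρ z = ρ x + 1) : IsRankFunction ρ := by
  refine ⟨fun x hx => ?_, fun x y h => rank_eq_of_covBy hstep h⟩
  rw [← hρb, (hx.eq_of_le (hb x))]

theorem IsMaxChain.mem_of_comparable {c : Set P} (hc : IsMaxChain (· ≤ ·) c) {z : P}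
    (h : ∀ w ∈ c, z ≤ w ∨ w ≤ z) : z ∈ c := by
  have := hc.2 (hc.1.insert fun w hw _ => h w hw) (Set.subset_insert z c)
  rw [this]
  exact Set.mem_insert z c

/-- The rank maps a maximal chain bijectively onto the integers from 0 to `ρ t`: at a missing value,
the step from the last chain element before the gap could be added to the chain. -/
theorem isPurePoset_of_step [Finite P] {ρ : P → ℤ} {b t : P} (hb : IsBot b) (ht : IsTop t)
    (hρb : ρ b = 0) (hρ : StrictMono ρ)
    (hstep : ∀ x y : P, x < y → ∃ z, x < z ∧ z ≤ y ∧ ρ z = ρ x + 1) : IsPurePoset P := by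
  refine ⟨(ρ t).toNat, fun c hc => ?_⟩
  have hcomp : ∀ x ∈ c, ∀ y ∈ c, ρ x ≤ ρ y → x ≤ y := by
    intro x hx y hy hxy
    rcases hc.1.total hx hy with h | h
    · exact h
    · rcases h.eq_or_lt with rfl | h
      · exact le_rfl
      · exact absurd (hρ h) (not_lt.2 hxy)
  have hinj : Set.InjOn ρ c := fun x hx y hy h =>
    le_antisymm (hcomp x hx y hy h.le) (hcomp y hy x hx h.ge)
  have hbc : b ∈ c := hc.mem_of_comparable fun w _ => Or.inl (hb w)
  have htc : t ∈ c := hc.mem_of_comparable fun w _ => Or.inr (ht w)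
  have himg : ρ '' c = ((Finset.Icc 0 (ρ t) : Finset ℤ) : Set ℤ) := by
    ext v
    rw [Finset.coe_Icc, Set.mem_Icc]
    constructor
    · rintro ⟨x, -, rfl⟩
      exact ⟨hρb ▸ hρ.monotone (hb x), hρ.monotone (ht x)⟩
    · rintro ⟨h0, h1⟩
      by_contra hv
      have hne : ∀ x ∈ c, ρ x ≠ v := fun x hx h => hv ⟨x, hx, h⟩
      obtain ⟨x, ⟨hxc, hxv⟩, hxmax⟩ := Set.exists_max_image {x | x ∈ c ∧ ρ x < v} ρ
        (Set.toFinite _) ⟨b, hbc, lt_of_le_of_ne (hρb ▸ h0) (hne b hbc)⟩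
      obtain ⟨y, ⟨hyc, hyv⟩, hymin⟩ := Set.exists_min_image {y | y ∈ c ∧ v < ρ y} ρ
        (Set.toFinite _) ⟨t, htc, lt_of_le_of_ne h1 (hne t htc).symm⟩
      have hxy : x < y := lt_of_le_of_ne (hcomp x hxc y hyc (hxv.trans hyv).le) (by
        rintro rfl
        exact lt_asymm hxv hyv)
      obtain ⟨z, hz1, hz2, hz3⟩ := hstep x y hxy
      have hzc : z ∈ c := by
        refine hc.mem_of_comparable fun w hw => ?_
        rcases lt_or_gt_of_ne (hne w hw) with h | h
        · exact Or.inr ((hcomp w hw x hxc (hxmax w ⟨hw, h⟩)).trans hz1.le)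
        · exact Or.inl (hz2.trans (hcomp y hyc w hw (hymin w ⟨hw, h⟩)))
      have := hne z hzc
      have := hxmax z ⟨hzc, by omega⟩
      omega
  have h0 : 0 ≤ ρ t := hρb ▸ hρ.monotone (hb t)
  rw [← hinj.encard_image, himg, Set.encard_coe_eq_coe_finsetCard, Int.card_Icc]
  have : (ρ t + 1 - 0).toNat = (ρ t).toNat + 1 := by omega
  rw [this]
  push_cast
  rfl

/-- Binary joins and a bottom give joins of all finite sets; the meet is the join of the common
lower bounds. -/
theorem isLatticeOrder_of_isLUB [Finite P] {b : P} (hb : IsBot b)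
    (h : ∀ x y : P, ∃ z, IsLUB {x, y} z) : IsLatticeOrder P := by
  have hsup : ∀ s : Set P, s.Finite → ∃ z, IsLUB s z := by
    intro s hs
    induction s, hs using Set.Finite.induction_on with
    | empty => exact ⟨b, by rwa [isLUB_empty_iff]⟩
    | @insert a s _ _ ih =>
      obtain ⟨z, hz⟩ := ih
      obtain ⟨w, hw⟩ := h a z
      refine ⟨w, ?_, fun u hu => hw.2 ?_⟩
      · rintro u (rfl | hu)
        · exact hw.1 (by simp)
        · exact (hz.1 hu).trans (hw.1 (by simp))
      · rintro v (rfl | rfl)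
        · exact hu (by simp)
        · exact hz.2 fun v hv => hu (by simp [hv])
  intro x y
  refine ⟨h x y, ?_⟩
  obtain ⟨z, hz⟩ := hsup (lowerBounds {x, y}) (Set.toFinite _)
  exact ⟨z, isLUB_lowerBounds.1 hz⟩

/-- An atom ordering of `[x, t]` is recursive if all atom orderings of the upper intervals
`[a_j, t]` are, and any two atoms below `y` satisfy the common cover condition. -/
theorem isRecAtomOrdering_of_forall [Finite P] {x t : P} (hlt : x < t) {l : List P}
    (hnd : l.Nodup) (hmem : ∀ a, a ∈ l ↔ x ⋖ a ∧ a ≤ t)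
    (hrec : ∀ a ∈ l, a < t → ∀ m : List P, m.Nodup → (∀ u, u ∈ m ↔ a ⋖ u ∧ u ≤ t) →
      IsRecAtomOrdering t a m)
    (hcover : ∀ i j : Fin l.length, i < j → ∀ y ≤ t, l.get i < y → l.get j < y →
        ∃ k < j, ∃ z, l.get j ⋖ z ∧ l.get k < z ∧ z ≤ y) :
    IsRecAtomOrdering t x l := by
  classical
  by_cases hcov : x ⋖ t
  · have : l = [t] := by
      refine List.perm_singleton.1 ((List.perm_ext_iff_of_nodup hnd (List.nodup_singleton t)).2 ?_)
      intro a
      rw [hmem, List.mem_singleton]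
      constructor
      · rintro ⟨h1, h2⟩
        exact h2.eq_of_not_lt (hcov.2 h1.lt)
      · rintro rfl
        exact ⟨hcov, le_rfl⟩
    rw [this]
    exact .length_one hcov
  -- Every ordering of the atoms of `[a_j, t]` is recursive, so those above an earlier atom may
  -- simply be put first.
  · have hm : ∀ j : Fin l.length, ∃ m : List P, m.Nodup ∧ (∀ u, u ∈ m ↔ l.get j ⋖ u ∧ u ≤ t) ∧
        m.Pairwise fun u v => (∃ i < j, l.get i ≤ v) → ∃ i < j, l.get i ≤ u := by
      intro j
      set L := (Set.toFinite {u | l.get j ⋖ u ∧ u ≤ t}).toFinset.toList with hL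
      have hLmem : ∀ u, u ∈ L ↔ l.get j ⋖ u ∧ u ≤ t := by
        intro u
        rw [hL, Finset.mem_toList, Set.Finite.mem_toFinset, Set.mem_ofPred_eq]
      have hLnd : L.Nodup := Finset.nodup_toList _
      refine ⟨L.filter (fun v => ∃ i < j, l.get i ≤ v) ++
        L.filter (fun v => ¬ ∃ i < j, l.get i ≤ v), ?_, ?_, ?_⟩
      · rw [List.nodup_append]
        refine ⟨hLnd.filter _, hLnd.filter _, fun a ha b hb hab => ?_⟩
        subst hab
        rw [List.mem_filter, decide_eq_true_iff] at ha hb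
        exact hb.2 ha.2
      · intro u
        rw [List.mem_append, List.mem_filter, List.mem_filter, decide_eq_true_iff,
          decide_eq_true_iff, ← hLmem, ← and_or_left]
        exact and_iff_left (em _)
      · rw [List.pairwise_append]
        refine ⟨?_, ?_, ?_⟩
        · rw [List.pairwise_filter]
          refine List.pairwise_of_forall fun u v hu _ _ => ?_
          rwa [decide_eq_true_iff] at hu
        · rw [List.pairwise_filter]
          refine List.pairwise_of_forall fun u v _ hv h => ?_
          rw [decide_eq_true_iff] at hv
          exact absurd h hv
        · intro u hu v _ _
          rw [List.mem_filter, decide_eq_true_iff] at hu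
          exact hu.2
    choose m hm1 hm2 hm3 using hm
    refine .length_gt_one hlt hcov hnd hmem m (fun j => ?_) hm3 hcover
    have hj := (hmem (l.get j)).1 (l.get_mem j)
    refine hrec _ (l.get_mem j) (lt_of_le_of_ne hj.2 fun h => hcov (h ▸ hj.1)) _ (hm1 j) (hm2 j)

/-- In the upper intervals of a semimodular poset every atom ordering is recursive. -/
theorem isRecAtomOrdering_of_semimodular [Finite P] {t : P} {S : P → Prop}
    (hS : ∀ x y, S x → x ≤ y → S y)
    (hsm : ∀ x u v y, S x → x ⋖ u → x ⋖ v → u ≠ v → u ≤ y → v ≤ y →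
      ∃ w, u ⋖ w ∧ v ⋖ w ∧ w ≤ y) {x : P} (hx : S x) (hlt : x < t) {l : List P}
    (hnd : l.Nodup) (hmem : ∀ a, a ∈ l ↔ x ⋖ a ∧ a ≤ t) : IsRecAtomOrdering t x l := by
  induction x using WellFoundedGT.induction generalizing l with
  | _ x ih =>
    refine isRecAtomOrdering_of_forall hlt hnd hmem (fun a ha hat m hm1 hm2 => ?_) ?_
    · have hxa := ((hmem a).1 ha).1
      exact ih a hxa.lt (hS x a hx hxa.le) hat hm1 hm2
    · intro i j hij y _ hi hj
      obtain ⟨w, h1, h2, h3⟩ := hsm x (l.get i) (l.get j) y hx ((hmem _).1 (l.get_mem i)).1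
        ((hmem _).1 (l.get_mem j)).1 (fun h => hij.ne (hnd.injective_get h)) hi.le hj.le
      exact ⟨i, hij, w, h2, h1.lt, h3⟩

/-- If the atoms of `[x, t]` carry a key such that of any two atoms below `y` one can be improved,
then the atoms sorted by their key satisfy the common cover condition. -/
theorem exists_isRecAtomOrdering_of_key [Finite P] {x t : P} (hlt : x < t)
    {K : Type*} [LinearOrder K] (key : P → K)
    (hkey : ∀ a a' y, x ⋖ a → x ⋖ a' → a ≠ a' → a < y → a' < y →
      (∃ b, x ⋖ b ∧ key b < key a ∧ ∃ z, a ⋖ z ∧ b < z ∧ z ≤ y) ∨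
      ∃ b, x ⋖ b ∧ key b < key a' ∧ ∃ z, a' ⋖ z ∧ b < z ∧ z ≤ y)
    (hrec : ∀ a, x ⋖ a → a < t → ∀ m : List P, m.Nodup → (∀ u, u ∈ m ↔ a ⋖ u ∧ u ≤ t) →
      IsRecAtomOrdering t a m) :
    ∃ l, IsRecAtomOrdering t x l := by
  classical
  set L := (Set.toFinite {u | x ⋖ u ∧ u ≤ t}).toFinset.toList with hL
  have htot : Std.Total fun u v : P => key u ≤ key v := ⟨fun u v => le_total _ _⟩
  have htrans : IsTrans P fun u v => key u ≤ key v := ⟨fun u v w => le_trans⟩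
  set l := L.insertionSort fun u v => key u ≤ key v with hl
  have hmem : ∀ u, u ∈ l ↔ x ⋖ u ∧ u ≤ t := by
    intro u
    rw [hl, List.mem_insertionSort, hL, Finset.mem_toList, Set.Finite.mem_toFinset,
      Set.mem_ofPred_eq]
  have hnd : l.Nodup := (List.perm_insertionSort _ L).nodup_iff.2 (Finset.nodup_toList _)
  have hsort : l.Pairwise fun u v => key u ≤ key v := List.pairwise_insertionSort _ L
  have hget : ∀ i j : Fin l.length, i < j → key (l.get i) ≤ key (l.get j) := fun i j hij =>
    List.pairwise_iff_get.1 hsort i j hij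
  -- Among the atoms below `y` other than `a` with key at most that of `a`, take `b0` of least key.
  -- Improving `b0` would contradict minimality, so `a` itself is improved. Ties between keys do no
  -- harm.
  have himp : ∀ a y, x ⋖ a → y ≤ t → a < y → ∀ b, x ⋖ b → b < y → key b ≤ key a → b ≠ a →
      ∃ b', x ⋖ b' ∧ key b' < key a ∧ ∃ z, a ⋖ z ∧ b' < z ∧ z ≤ y := by
    intro a y ha hyt hay b hb hby hba hne
    by_contra hcon
    have hfin := Set.toFinite {b | x ⋖ b ∧ b < y ∧ key b ≤ key a ∧ b ≠ a}
    obtain ⟨b0, ⟨hb0, hb0y, hb0a, hb0ne⟩, hmin⟩ :=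
      Set.exists_min_image _ key hfin ⟨b, hb, hby, hba, hne⟩
    rcases hkey a b0 y ha hb0 hb0ne.symm hay hb0y with h | ⟨b', h1, h2, z, h3, h4, h5⟩
    · exact hcon h
    · have hb'a := h2.trans_le hb0a
      exact absurd (hmin b' ⟨h1, h4.trans_le h5, hb'a.le, fun h => by
        rw [h] at hb'a; exact lt_irrefl _ hb'a⟩) (not_le.2 h2)
  refine ⟨l, isRecAtomOrdering_of_forall hlt hnd hmem
    (fun a ha => hrec a ((hmem a).1 ha).1) ?_⟩
  intro i j hij y hyt hiy hjy
  have hi := (hmem _).1 (l.get_mem i)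
  have hj := (hmem _).1 (l.get_mem j)
  obtain ⟨b, h1, h2, z, h3, h4, h5⟩ := himp _ y hj.1 hyt hjy _ hi.1 hiy (hget i j hij)
    fun h => hij.ne (hnd.injective_get h)
  -- The strictly smaller key places `b` before position `j` in the sorted list.
  obtain ⟨m, hm⟩ := List.mem_iff_get.1 ((hmem b).2 ⟨h1, (h4.le.trans h5).trans hyt⟩)
  refine ⟨m, ?_, z, h3, hm ▸ h4, h5⟩
  by_contra hjm
  rcases (not_lt.1 hjm).eq_or_lt with h | h
  · rw [← hm, h] at h2
    exact lt_irrefl _ h2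
  · exact absurd (hget j m h) (not_le.2 (hm ▸ h2))

end Poset

/-! ### The key of an atom and the three ways to improve it -/

namespace Dowling

variable {n r : ℕ} {κ : Type} {d k : ℕ}

/-- The least element above `x` satisfying `e` lies below `z` and has as many blocks, so it is `z`.
-/
theorem le_of_step {x y z : Dowling n r} {e : Fin n ⊕ (Fin n × Fin n × ZMod r)} (hxz : x ≤ z)
    (hz : z.numBlocks + 1 = x.numBlocks) (hze : z.Holds e) (hxe : ¬ x.Holds e) (hxy : x ≤ y)
    (hye : y.Holds e) : z ≤ y := by
  obtain ⟨w, h1, h2, h3, h4⟩ := exists_least_of_not_holds hxe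
  rcases eq_or_lt_of_merges (h4 z hxz hze) with rfl | h
  · exact h4 y hxy hye
  · omega

theorem mem_zeroBlock_iff_of_le {I : Finset (Fin n)} {c : Fin n → κ} {γ : Fin n → ZMod r}
    {y : Dowling n r} (h : ofMap I c γ ≤ y) {a b : Fin n} (ha : a ∉ I) (hb : b ∉ I)
    (hab : c a = c b) : a ∈ y.zeroBlock ↔ b ∈ y.zeroBlock := by
  rcases (ofMap_le_iff.1 h).2 a ha b hb hab with h | h
  · exact iff_of_true h.1 h.2
  · exact iff_of_false h.notMem_left h.notMem_right

theorem fibre_map (σ : Equiv.Perm (Fin n)) (I : Finset (Fin n)) (c : Fin n → κ) (i : κ) :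
    fibre (I.map σ.toEmbedding) (c ∘ σ.symm) i = (fibre I c i).map σ.toEmbedding := by
  ext a
  rw [mem_fibre, mem_map_equiv, mem_map_equiv, mem_fibre, Function.comp_apply]

theorem Balanced.map {I : Finset (Fin n)} {c : Fin n → κ} {χ : Fin n → ZMod k}
    (h : Balanced d I c χ) (σ : Equiv.Perm (Fin n)) :
    Balanced d (I.map σ.toEmbedding) (c ∘ σ.symm) (χ ∘ σ.symm) := by
  intro i
  rw [fibre_map, card_map]
  refine ⟨(h i).1, fun s t => ?_⟩
  simp only [filter_map, card_map]
  simpa [Function.comp_def] using (h i).2 s t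

theorem image_compl_map [DecidableEq κ] (σ : Equiv.Perm (Fin n)) (I : Finset (Fin n))
    (c : Fin n → κ) : (I.map σ.toEmbedding)ᶜ.image (c ∘ σ.symm) = Iᶜ.image c := by
  ext i
  simp only [mem_image, mem_compl, mem_map_equiv, Function.comp_apply]
  constructor
  · rintro ⟨a, ha, rfl⟩
    exact ⟨σ.symm a, ha, rfl⟩
  · rintro ⟨a, ha, rfl⟩
    exact ⟨σ a, by simpa using ha, by simp⟩

theorem numBlocks_map (σ : Equiv.Perm (Fin n)) (I : Finset (Fin n)) (c : Fin n → κ)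
    (γ γ' : Fin n → ZMod r) :
    (ofMap (I.map σ.toEmbedding) (c ∘ σ.symm) γ').numBlocks = (ofMap I c γ).numBlocks := by
  classical
  rw [numBlocks_ofMap, numBlocks_ofMap, image_compl_map]

/-- The sum of the elements of the zero block. -/
def zeroSum (x : Dowling n r) : ℤ := ∑ a ∈ x.zeroBlock, ((a : ℕ) : ℤ)

/-- The sum of the squares of the sums of the nonzero blocks. -/
def squareSum (x : Dowling n r) : ℤ :=
  Quotient.lift (fun p : Prepartition n r => ∑ B ∈ p.blocks, (∑ a ∈ B, ((a : ℕ) : ℤ)) ^ 2)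
    (fun p q (h : p.Equivalent q) => by simp only [h.2.1]) x

open Classical in
/-- The sum of the codes of the labels of the nonzero blocks. -/
noncomputable def labelSum (enc : (Fin n → ZMod r → Prop) → ℕ) (x : Dowling n r) : ℕ :=
  ∑ a, if a ∉ x.zeroBlock ∧ ∀ b g, x.Rel a b g → a ≤ b then enc (x.Rel a) else 0

/-- The key by which the atoms are ordered. -/
noncomputable def key (enc : (Fin n → ZMod r → Prop) → ℕ) (x : Dowling n r) : ℤ ×ₗ ℤ ×ₗ ℕ :=
  toLex (x.zeroSum, toLex (-x.squareSum, labelSum enc x))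

theorem fibre_injOn [DecidableEq κ] (I : Finset (Fin n)) (c : Fin n → κ) :
    Set.InjOn (fibre I c) (Iᶜ.image c : Finset κ) := by
  intro i hi j hj h
  obtain ⟨a, ha⟩ := fibre_nonempty (mem_coe.1 hi)
  exact (mem_fibre.1 ha).2.symm.trans (mem_fibre.1 (h ▸ ha)).2

theorem squareSum_ofMap [DecidableEq κ] (I : Finset (Fin n)) (c : Fin n → κ)
    (γ : Fin n → ZMod r) : (ofMap I c γ).squareSum =
      ∑ i ∈ Iᶜ.image c, (∑ a ∈ fibre I c i, ((a : ℕ) : ℤ)) ^ 2 := by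
  have : (ofMap I c γ).squareSum =
    ∑ B ∈ (preOfMap I c γ).blocks, (∑ a ∈ B, ((a : ℕ) : ℤ)) ^ 2 := rfl
  rw [this, blocks_preOfMap, sum_image (fibre_injOn I c)]

/-- Some element with as many nonzero blocks as `a`, but a smaller key, lies below an element of
the interval `[a, y]` that arises from `a` by one merge. -/
def Improvable (enc : (Fin n → ZMod r → Prop) → ℕ) (d : ℕ) (hkr : k ∣ r) (y a : Dowling n r) :
    Prop :=
  ∃ b z : Dowling n r, IsGood d hkr b ∧ b.numBlocks = a.numBlocks ∧ key enc b < key enc a ∧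
    a < z ∧ z.numBlocks + 1 = a.numBlocks ∧ b ≤ z ∧ z ≤ y

variable {enc : (Fin n → ZMod r → Prop) → ℕ} {hkr : k ∣ r}

theorem swap_map_mem {e f a : Fin n} {I : Finset (Fin n)} :
    a ∈ I.map (Equiv.swap e f).toEmbedding ↔ Equiv.swap e f a ∈ I := by
  rw [mem_map_equiv, Equiv.symm_swap]

/-- Exchanging `e` and `f` lowers the sum of the zero block by f - e. Both elements lie below the
one obtained by merging the block of `e` into the zero block, which is below `y` because `e` is in
the zero block of `y`. -/
theorem improvable_of_zero {I : Finset (Fin n)} {c : Fin n → κ} {γ : Fin n → ZMod r}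
    {y : Dowling n r} (hg : IsGood d hkr (ofMap I c γ)) (hy : ofMap I c γ ≤ y) {e f : Fin n}
    (he : e ∉ I) (hf : f ∈ I) (hef : e < f) (hey : e ∈ y.zeroBlock) :
    Improvable enc d hkr y (ofMap I c γ) := by
  set σ := Equiv.swap e f with hσ
  have hmerge := merge_zero_ofMap (c := c) (γ := γ) he
  have hnum := numBlocks_merge_zero (c := c) (γ := γ) he
  refine ⟨ofMap (I.map σ.toEmbedding) (c ∘ σ.symm) (γ ∘ σ.symm),
    ofMap (I ∪ fibre I c (c e)) c γ, ⟨?_, ?_⟩, numBlocks_map _ _ _ _ _, ?_, lt_of_merge hmerge,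
    hnum, ?_, ?_⟩
  · rw [zeroBlock_ofMap, card_map]
    exact hg.1
  · rw [isBalanced_ofMap]
    exact (isBalanced_ofMap.1 hg.2).map σ
  · rw [key, key, Prod.Lex.toLex_lt_toLex]
    left
    change zeroSum _ < zeroSum _
    rw [zeroSum, zeroSum, zeroBlock_ofMap, zeroBlock_ofMap, sum_map]
    refine sum_lt_sum (fun a ha => ?_) ⟨f, hf, ?_⟩
    · have hae : a ≠ e := fun h => he (h ▸ ha)
      by_cases haf : a = f
      · subst haf
        simpa [hσ] using hef.le
      · simp [hσ, Equiv.swap_apply_of_ne_of_ne hae haf]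
    · simpa [hσ] using hef
  · have hz : ∀ a, a ∉ I.map σ.toEmbedding → c (σ a) = c e → a ∈ I ∪ fibre I c (c e) := by
      intro a ha hac
      rw [hσ, swap_map_mem] at ha
      rw [mem_union, mem_fibre]
      by_cases hae : a = e
      · subst hae
        simp [he]
      by_cases haf : a = f
      · subst haf
        exact Or.inl hf
      · rw [Equiv.swap_apply_of_ne_of_ne hae haf] at ha
        rw [hσ, Equiv.swap_apply_of_ne_of_ne hae haf] at hac
        exact Or.inr ⟨ha, hac⟩
    have hnz : ∀ a, a ∉ I.map σ.toEmbedding → c (σ a) ≠ c e → σ a = a := by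
      intro a ha hac
      rw [hσ, swap_map_mem] at ha
      refine Equiv.swap_apply_of_ne_of_ne ?_ ?_
      · rintro rfl
        exact ha (by simpa using hf)
      · rintro rfl
        exact hac (by simp [hσ])
    rw [ofMap_le_ofMap_iff]
    constructor
    · intro a ha
      rw [hσ, swap_map_mem] at ha
      rw [mem_union, mem_fibre]
      by_cases haI : a ∈ I
      · exact Or.inl haI
      · right
        have hae : a = e := by
          by_contra hae
          by_cases haf : a = f
          · exact haI (haf ▸ hf)
          · rw [Equiv.swap_apply_of_ne_of_ne hae haf] at ha
            exact haI ha
        exact ⟨haI, by rw [hae]⟩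
    · intro a ha b hb hab
      have hab' : c (σ a) = c (σ b) := by simpa [hσ] using hab
      by_cases hac : c (σ a) = c e
      · exact Or.inl ⟨hz a ha hac, hz b hb (hab'.symm.trans hac)⟩
      · have hbc : c (σ b) ≠ c e := fun h => hac (hab'.trans h)
        have h1 := hnz a ha hac
        have h2 := hnz b hb hbc
        have hmem : ∀ u, u ∉ I.map σ.toEmbedding → σ u = u → c u ≠ c e →
            u ∉ I ∪ fibre I c (c e) := by
          intro u hu huu huc
          rw [hσ, swap_map_mem, ← hσ, huu] at hu
          rw [mem_union, mem_fibre, not_or, not_and]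
          exact ⟨hu, fun _ => huc⟩
        rw [h1] at hac hab'
        rw [h2] at hbc hab'
        refine Or.inr ⟨hmem a ha h1 hac, hmem b hb h2 hbc, hab', ?_⟩
        have hs : σ.symm = σ := Equiv.symm_swap e f
        rw [Function.comp_apply, Function.comp_apply, hs, h1, h2]
  · refine le_of_step (e := Sum.inl e) (lt_of_merge hmerge).le hnum ?_ he hy hey
    rw [holds_inl, zeroBlock_ofMap, mem_union, mem_fibre]
    exact Or.inr ⟨he, rfl⟩

theorem shift_left {c : Fin n → κ} {γ : Fin n → ZMod r} {a b : Fin n} {g : ZMod r}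
    (h : c a ≠ c b) : shift c γ a b g a = γ a := if_neg h

theorem shift_right {c : Fin n → κ} {γ : Fin n → ZMod r} {a b : Fin n} {g : ZMod r} :
    shift c γ a b g b = γ a + g := by
  unfold shift
  rw [if_pos rfl]
  abel

/-- With D = f - e, the sums S_e ≥ S_f of the two blocks become S_e + D and S_f - D, so the sum of
squares grows by 2D(S_e - S_f) + 2D² > 0. -/
theorem squareSum_swap_lt {I : Finset (Fin n)} {c : Fin n → κ} {γ γ' : Fin n → ZMod r}
    {e f : Fin n} (he : e ∉ I) (hf : f ∉ I) (hc : c e ≠ c f) (hef : e < f)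
    (hS : ∑ a ∈ fibre I c (c f), ((a : ℕ) : ℤ) ≤ ∑ a ∈ fibre I c (c e), ((a : ℕ) : ℤ)) :
    (ofMap I c γ).squareSum < (ofMap (I.map (Equiv.swap e f).toEmbedding)
      (c ∘ (Equiv.swap e f).symm) γ').squareSum := by
  classical
  rw [squareSum_ofMap, squareSum_ofMap, image_compl_map]
  simp only [fibre_map, sum_map, Equiv.coe_toEmbedding]
  set D : ℤ := (f : ℕ) - (e : ℕ) with hD
  have hDpos : 0 < D := by
    have : (e : ℕ) < f := hef
    omega
  have hsw : ∀ a : Fin n, ((Equiv.swap e f a : ℕ) : ℤ) =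
      (a : ℕ) + ((if a = e then D else 0) + if a = f then -D else 0) := by
    intro a
    have hne : e ≠ f := hef.ne
    by_cases hae : a = e
    · subst hae
      simp [hne, hD]
    · by_cases haf : a = f
      · subst haf
        simp [hae, hD]
      · simp [Equiv.swap_apply_of_ne_of_ne hae haf, hae, haf]
  have hsum : ∀ i, ∑ a ∈ fibre I c i, ((Equiv.swap e f a : ℕ) : ℤ) =
      ∑ a ∈ fibre I c i, ((a : ℕ) : ℤ) +
        ((if c e = i then D else 0) + if c f = i then -D else 0) := by
    intro i
    simp only [hsw, sum_add_distrib, sum_ite_eq', mem_fibre, he, hf, not_false_eq_true, true_and]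
  rw [← sub_pos, ← sum_sub_distrib]
  have hsub : ({c e, c f} : Finset κ) ⊆ Iᶜ.image c := by
    intro i hi
    rw [mem_insert, mem_singleton] at hi
    rcases hi with rfl | rfl
    · exact mem_image_of_mem _ (mem_compl.2 he)
    · exact mem_image_of_mem _ (mem_compl.2 hf)
  rw [← sum_subset hsub, sum_pair hc, hsum, hsum]
  · simp only [if_true, if_neg hc, if_neg hc.symm]
    nlinarith [mul_nonneg hDpos.le (sub_nonneg.2 hS)]
  · intro i _ hi
    rw [mem_insert, mem_singleton, not_or] at hi
    rw [hsum, if_neg (Ne.symm hi.1), if_neg (Ne.symm hi.2)]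
    ring

/-- Translate the block of `e` so that `e` and `f` have label difference `g`, then exchange their
blocks while each keeps its label. As `g` vanishes mod k, both have the same colour and the blocks
stay even. Both elements lie below the merge of the two blocks with difference `g`. -/
theorem improvable_of_swap {I : Finset (Fin n)} {c : Fin n → κ} {γ : Fin n → ZMod r}
    {y : Dowling n r} (hg : IsGood d hkr (ofMap I c γ)) (hy : ofMap I c γ ≤ y) {e f : Fin n}
    (he : e ∉ I) (hf : f ∉ I) (hc : c e ≠ c f) (hef : e < f)
    (hS : ∑ a ∈ fibre I c (c f), ((a : ℕ) : ℤ) ≤ ∑ a ∈ fibre I c (c e), ((a : ℕ) : ℤ))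
    {g : ZMod r} (hyg : y.Holds (Sum.inr (f, e, g))) (hg0 : ZMod.castHom hkr (ZMod k) g = 0) :
    Improvable enc d hkr y (ofMap I c γ) := by
  set σ := Equiv.swap e f with hσ
  have hs : σ.symm = σ := Equiv.symm_swap e f
  set γ' := shift c γ f e g with hγ'
  have hγ : ofMap I c γ = ofMap I c γ' := ofMap_congr (fun _ _ _ _ => Iff.rfl)
    fun a _ b _ hab => (shift_sub hab).symm
  have hI : I.map σ.toEmbedding = I := by
    ext a
    rw [hσ, swap_map_mem]
    by_cases hae : a = e
    · subst hae
      simp [he, hf]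
    · by_cases haf : a = f
      · subst haf
        simp [he, hf]
      · rw [Equiv.swap_apply_of_ne_of_ne hae haf]
  have hχ : (fun a => ZMod.castHom hkr (ZMod k) (γ' a)) ∘ σ.symm =
      fun a => ZMod.castHom hkr (ZMod k) (γ' a) := by
    have h1 : ZMod.castHom hkr (ZMod k) (γ' e) = ZMod.castHom hkr (ZMod k) (γ' f) := by
      rw [hγ', shift_right, shift_left hc.symm, map_add, hg0, add_zero]
    funext a
    rw [hs, Function.comp_apply]
    by_cases hae : a = e
    · subst hae
      rw [hσ, Equiv.swap_apply_left, h1]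
    · by_cases haf : a = f
      · subst haf
        rw [hσ, Equiv.swap_apply_right, h1]
      · rw [hσ, Equiv.swap_apply_of_ne_of_ne hae haf]
  have hmerge := merge_nonzero_ofMap (γ := γ) hf he hc.symm g
  have hnum := numBlocks_merge_nonzero (γ := γ) (γ' := γ') hf he hc.symm
  have hbal : Balanced d I c fun a => ZMod.castHom hkr (ZMod k) (γ' a) :=
    isBalanced_ofMap.1 (hγ ▸ hg.2)
  have hsq := squareSum_swap_lt (γ := γ) (γ' := γ') he hf hc hef hS
  have hnum' := numBlocks_map σ I c γ γ'
  have hbal' := hbal.map σ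
  rw [← hσ] at hsq
  rw [hI] at hsq hnum' hbal'
  rw [hχ] at hbal'
  refine ⟨ofMap I (c ∘ σ.symm) γ', ofMap I (glue c f e) γ', ⟨hg.1, isBalanced_ofMap.2 hbal'⟩,
    hnum', ?_, lt_of_merge hmerge, hnum, ?_, ?_⟩
  · rw [key, key, Prod.Lex.toLex_lt_toLex]
    right
    refine ⟨rfl, ?_⟩
    rw [Prod.Lex.toLex_lt_toLex]
    left
    exact neg_lt_neg hsq
  · rw [ofMap_le_ofMap_iff]
    refine ⟨Subset.rfl, fun a ha b hb hab => Or.inr ⟨ha, hb, ?_, rfl⟩⟩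
    have hglue : ∀ u, glue c f e (σ.symm u) = glue c f e u := by
      intro u
      rw [hs, glue_eq_iff]
      by_cases hue : u = e
      · subst hue
        simp [hσ]
      · by_cases huf : u = f
        · subst huf
          simp [hσ]
        · rw [hσ, Equiv.swap_apply_of_ne_of_ne hue huf]
          exact Or.inl rfl
    rw [← hglue a, ← hglue b]
    exact glue_eq hab
  · have hz : (ofMap I (glue c f e) γ').Holds (Sum.inr (f, e, g)) := by
      refine Or.inr (rel_ofMap.2 ⟨hf, he, ?_, ?_⟩)
      · rw [glue_eq_iff]
        tauto
      · rw [hγ', shift_right, shift_left hc.symm]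
    refine le_of_step (lt_of_merge hmerge).le hnum hz ?_ hy hyg
    · rw [holds_inr, rel_ofMap, zeroBlock_ofMap]
      rintro (h | h)
      · exact hf h.1
      · exact hc h.2.2.1.symm

/-- Merging the block of `u` into the zero block forgets its labels, so that block may take the
labels `γ'`. Only the term of `labelSum` at `u`, the least element of the block, changes. -/
theorem improvable_of_label {I : Finset (Fin n)} {c : Fin n → κ} {γ γ' : Fin n → ZMod r}
    {y : Dowling n r} (hg : IsGood d hkr (ofMap I c γ)) (hg' : IsGood d hkr (ofMap I c γ'))
    (hy : ofMap I c γ ≤ y) {u : Fin n} (hu : u ∉ I) (huy : u ∈ y.zeroBlock)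
    (hmin : ∀ v ∈ fibre I c (c u), u ≤ v)
    (henc : enc ((ofMap I c γ').Rel u) < enc ((ofMap I c γ).Rel u)) :
    Improvable enc d hkr y (ofMap I c γ) := by
  classical
  have hmerge := merge_zero_ofMap (c := c) (γ := γ) hu
  have hnum := numBlocks_merge_zero (c := c) (γ := γ) hu
  set γ'' : Fin n → ZMod r := fun w => if c w = c u then γ' w else γ w with hγ''
  refine ⟨ofMap I c γ'', ofMap (I ∪ fibre I c (c u)) c γ, ⟨hg.1, isBalanced_ofMap.2 fun i => ?_⟩,
    ?_, ?_, lt_of_merge hmerge, hnum, ?_, ?_⟩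
  · have hb := isBalanced_ofMap.1 hg.2 i
    have hb' := isBalanced_ofMap.1 hg'.2 i
    refine ⟨hb.1, fun s t => ?_⟩
    by_cases hi : i = c u
    · have : ∀ s : ZMod k, ((fibre I c i).filter fun a => ZMod.castHom hkr (ZMod k) (γ'' a) = s) =
          (fibre I c i).filter fun a => ZMod.castHom hkr (ZMod k) (γ' a) = s := by
        intro s
        refine filter_congr fun a ha => ?_
        rw [hγ'']
        simp only [if_pos ((mem_fibre.1 ha).2.trans hi)]
      rw [this, this]
      exact hb'.2 s t
    · have : ∀ s : ZMod k, ((fibre I c i).filter fun a => ZMod.castHom hkr (ZMod k) (γ'' a) = s) =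
          (fibre I c i).filter fun a => ZMod.castHom hkr (ZMod k) (γ a) = s := by
        intro s
        refine filter_congr fun a ha => ?_
        have : c a ≠ c u := fun h => hi ((mem_fibre.1 ha).2.symm.trans h)
        rw [hγ'']
        simp only [if_neg this]
      rw [this, this]
      exact hb.2 s t
  · rw [numBlocks_ofMap, numBlocks_ofMap]
  · rw [key, key, Prod.Lex.toLex_lt_toLex]
    refine Or.inr ⟨rfl, ?_⟩
    rw [Prod.Lex.toLex_lt_toLex]
    refine Or.inr ⟨by simp only [squareSum_ofMap], ?_⟩
    change labelSum enc _ < labelSum enc _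
    have hcond : ∀ (δ : Fin n → ZMod r) (a : Fin n),
        (a ∉ (ofMap I c δ).zeroBlock ∧ ∀ b g, (ofMap I c δ).Rel a b g → a ≤ b) ↔
          (a ∉ I ∧ ∀ b ∉ I, c a = c b → a ≤ b) := by
      intro δ a
      rw [zeroBlock_ofMap]
      refine and_congr_right fun ha => ⟨fun h b hb hab => ?_, fun h b g hr => ?_⟩
      · exact h b (δ b - δ a) (rel_ofMap.2 ⟨ha, hb, hab, (add_sub_cancel _ _).symm⟩)
      · exact h b (rel_ofMap.1 hr).2.1 (rel_ofMap.1 hr).2.2.1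
    have hrow : ∀ w, c w ≠ c u → (ofMap I c γ'').Rel w = (ofMap I c γ).Rel w := by
      intro w hw
      funext b g
      rw [eq_iff_iff, rel_ofMap, rel_ofMap]
      refine and_congr_right fun _ => and_congr_right fun _ => and_congr_right fun hwb => ?_
      rw [hγ'']
      simp only [if_neg hw, if_neg (hwb ▸ hw)]
    have hrow' : (ofMap I c γ'').Rel u = (ofMap I c γ').Rel u := by
      funext b g
      rw [eq_iff_iff, rel_ofMap, rel_ofMap]
      refine and_congr_right fun _ => and_congr_right fun _ => and_congr_right fun hub => ?_
      rw [hγ'']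
      simp only [if_pos hub.symm, if_true]
    have hu' : u ∉ I ∧ ∀ b ∉ I, c u = c b → u ≤ b :=
      ⟨hu, fun b hb hub => hmin b (mem_fibre.2 ⟨hb, hub.symm⟩)⟩
    unfold labelSum
    simp only [hcond]
    refine sum_lt_sum (fun w _ => ?_) ⟨u, mem_univ u, ?_⟩
    · split_ifs with hw
      · by_cases hwu : c w = c u
        · obtain rfl : w = u := le_antisymm (hw.2 u hu hwu) (hu'.2 w hw.1 hwu.symm)
          rw [hrow']
          exact henc.le
        · rw [hrow w hwu]
      · exact le_rfl
    · rw [if_pos hu', if_pos hu', hrow']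
      exact henc
  · rw [ofMap_le_ofMap_iff]
    refine ⟨subset_union_left, fun a ha b hb hab => ?_⟩
    by_cases hau : c a = c u
    · exact Or.inl ⟨mem_union_right _ (mem_fibre.2 ⟨ha, hau⟩),
        mem_union_right _ (mem_fibre.2 ⟨hb, hab.symm.trans hau⟩)⟩
    · have hbu : c b ≠ c u := fun h => hau (hab.trans h)
      have hmem : ∀ w, w ∉ I → c w ≠ c u → w ∉ I ∪ fibre I c (c u) := by
        intro w hw hwu
        rw [mem_union, mem_fibre, not_or, not_and]
        exact ⟨hw, fun _ => hwu⟩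
      refine Or.inr ⟨hmem a ha hau, hmem b hb hbu, hab, ?_⟩
      rw [hγ'']
      simp only [if_neg hau, if_neg hbu]
  · refine le_of_step (e := Sum.inl u) (lt_of_merge hmerge).le hnum ?_ hu hy huy
    rw [holds_inl, zeroBlock_ofMap, mem_union, mem_fibre]
    exact Or.inr ⟨hu, rfl⟩

end Dowling

/-! ### Blocks as consecutive runs -/

section Classes

variable {α κ τ υ R : Type*} [LinearOrder α] [DecidableEq κ] [DecidableEq τ] [DecidableEq υ]
  [LinearOrder R] {A : Finset α} {c : α → κ} {G : α → τ} {Y : α → υ} {S : κ → R} {N : υ → ℕ}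

/-- By `hS`, a class of `G` runs through the blocks of its `Y`-class in the order of `S`, with `N (Y
u)` elements in each. The elements before `u` are thus the full runs of the blocks with smaller `S`
and part of the run of `u`, so the quotient counts the earlier blocks. -/
theorem card_filter_lt_div (hN : ∀ y, 0 < N y) (hGY : ∀ a b, G a = G b → Y a = Y b)
    (hcard : ∀ u ∈ A, ∀ w ∈ A, Y w = Y u →
      (A.filter fun b => G b = G u ∧ c b = c w).card = N (Y u))
    (hS : ∀ u ∈ A, ∀ v ∈ A, G u = G v → c u ≠ c v → u < v → S (c u) < S (c v))
    {u : α} (hu : u ∈ A) :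
    (A.filter fun b => G b = G u ∧ b < u).card / N (Y u) =
      (((A.filter fun w => Y w = Y u).image c).filter fun i => S i < S (c u)).card := by
  set T := (A.filter fun w => Y w = Y u).image c with hT
  have hcardT : ∀ i ∈ T, (A.filter fun b => G b = G u ∧ c b = i).card = N (Y u) := by
    intro i hi
    obtain ⟨w, hw, rfl⟩ := mem_image.1 hi
    rw [mem_filter] at hw
    exact hcard u hu w hw.1 hw.2
  have hterm : ∀ i ∈ T, ((A.filter fun b => G b = G u ∧ b < u).filter fun b => c b = i).card =
      (if S i < S (c u) then N (Y u) else 0) + if i = c u then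
        ((A.filter fun b => G b = G u ∧ b < u).filter fun b => c b = c u).card else 0 := by
    intro i hi
    by_cases hiu : i = c u
    · subst hiu
      simp
    rw [if_neg hiu, add_zero]
    split_ifs with h
    · rw [← hcardT i hi]
      congr 1
      ext b
      simp only [mem_filter]
      constructor
      · rintro ⟨⟨h1, h2, -⟩, h3⟩
        exact ⟨h1, h2, h3⟩
      · rintro ⟨h1, h2, rfl⟩
        refine ⟨⟨h1, h2, ?_⟩, rfl⟩
        rcases lt_trichotomy b u with h3 | rfl | h3
        · exact h3
        · exact absurd rfl hiu
        · exact absurd (hS u hu b h1 h2.symm (Ne.symm hiu) h3) (not_lt.2 h.le)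
    · rw [card_eq_zero, filter_eq_empty_iff]
      intro b hb hbi
      rw [mem_filter] at hb
      subst hbi
      exact h (hS b hb.1 u hu hb.2.1 hiu hb.2.2)
  have hsum : (A.filter fun b => G b = G u ∧ b < u).card =
      N (Y u) * (T.filter fun i => S i < S (c u)).card +
        ((A.filter fun b => G b = G u ∧ b < u).filter fun b => c b = c u).card := by
    rw [card_eq_sum_card_fiberwise (s := A.filter fun b => G b = G u ∧ b < u) (f := c) (t := T),
      sum_congr rfl hterm, sum_add_distrib, ← sum_filter, sum_const, smul_eq_mul, mul_comm,
      sum_ite_eq', if_pos]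
    · exact mem_image_of_mem c (mem_filter.2 ⟨hu, rfl⟩)
    · intro b hb
      rw [mem_coe, mem_filter] at hb
      exact mem_image_of_mem c (mem_filter.2 ⟨hb.1, hGY _ _ hb.2.1⟩)
  -- The run of `u` is counted incompletely, since `u` itself is missing; so it does not affect the
  -- quotient.
  have hlt : ((A.filter fun b => G b = G u ∧ b < u).filter fun b => c b = c u).card < N (Y u) := by
    rw [← hcard u hu u hu rfl]
    refine card_lt_card ⟨?_, fun h => ?_⟩
    · intro b hb
      simp only [mem_filter] at hb ⊢
      exact ⟨hb.1.1, hb.1.2.1, hb.2⟩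
    · have := h (mem_filter.2 ⟨hu, rfl, rfl⟩)
      simp at this
  rw [hsum, Nat.mul_add_div (hN _), Nat.div_eq_of_lt hlt, add_zero]

/-- The block is recovered from its position among the blocks of its `Y`-class. The point is that
the right-hand side mentions neither `c` nor `S`. -/
theorem class_eq_iff (hN : ∀ y, 0 < N y) (hGY : ∀ a b, G a = G b → Y a = Y b)
    (hcY : ∀ a ∈ A, ∀ b ∈ A, c a = c b → Y a = Y b)
    (hcard : ∀ u ∈ A, ∀ w ∈ A, Y w = Y u →
      (A.filter fun b => G b = G u ∧ c b = c w).card = N (Y u))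
    (hS : ∀ u ∈ A, ∀ v ∈ A, G u = G v → c u ≠ c v → u < v → S (c u) < S (c v))
    {u v : α} (hu : u ∈ A) (hv : v ∈ A) :
    c u = c v ↔ Y u = Y v ∧ (A.filter fun b => G b = G u ∧ b < u).card / N (Y u) =
      (A.filter fun b => G b = G v ∧ b < v).card / N (Y v) := by
  rw [card_filter_lt_div hN hGY hcard hS hu, card_filter_lt_div hN hGY hcard hS hv]
  constructor
  · intro h
    have := hcY u hu v hv h
    rw [this, h]
    exact ⟨rfl, rfl⟩
  · rintro ⟨hY, h⟩
    rw [hY] at h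
    have hmem : ∀ w ∈ A, Y w = Y v → c w ∈ (A.filter fun w => Y w = Y v).image c := fun w hw hwY =>
      mem_image_of_mem c (mem_filter.2 ⟨hw, hwY⟩)
    have hSeq : S (c u) = S (c v) := by
      have key : ∀ w ∈ A, ∀ w' : α, Y w = Y v → S (c w) < S (c w') →
          (((A.filter fun w => Y w = Y v).image c).filter fun i => S i < S (c w)).card <
          (((A.filter fun w => Y w = Y v).image c).filter fun i => S i < S (c w')).card := by
        intro w hw w' hwY hlt
        refine card_lt_card ⟨?_, fun hsub => ?_⟩
        · intro i hi
          rw [mem_filter] at hi ⊢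
          exact ⟨hi.1, hi.2.trans hlt⟩
        · have := hsub (mem_filter.2 ⟨hmem w hw hwY, hlt⟩)
          exact lt_irrefl _ (mem_filter.1 this).2
      rcases lt_trichotomy (S (c u)) (S (c v)) with h' | h' | h'
      · exact absurd h (key u hu v hY h').ne
      · exact h'
      · exact absurd h (key v hv u rfl h').ne'
    by_contra hne
    -- `S` is not assumed injective, but the block of `v` meets the `G`-class of `u`, and there `hS`
    -- separates distinct blocks.
    have hpos := hcard u hu v hv hY.symm ▸ hN (Y u)
    obtain ⟨w, hw⟩ := card_pos.1 hpos
    obtain ⟨hwA, hwG, hwc⟩ := mem_filter.1 hw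
    have hne' : c u ≠ c w := fun h => hne (h.trans hwc)
    rcases lt_trichotomy u w with h1 | rfl | h1
    · have := hS u hu w hwA hwG.symm hne' h1
      rw [hwc, hSeq] at this
      exact lt_irrefl _ this
    · exact hne' rfl
    · have := hS w hwA u hu hwG hne'.symm h1
      rw [hwc, hSeq] at this
      exact lt_irrefl _ this

end Classes

/-! ### Uniqueness of the unimprovable atom -/

namespace Dowling

variable {n r d k : ℕ} {enc : (Fin n → ZMod r → Prop) → ℕ} {hkr : k ∣ r}

/-- The equation for n turns the lower bounds d + 1 for the zero block and d for the nonzero blocks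
into equalities. -/
theorem atom_card {κ : Type} {I : Finset (Fin n)} {c : Fin n → κ} {γ : Fin n → ZMod r}
    (hg : IsGood d hkr (ofMap I c γ)) (hd : 2 ≤ d) (hnd : n ≡ 1 [MOD d])
    (hm : d * (ofMap I c γ).numBlocks + d + 1 = n) :
    I.card = d + 1 ∧ ∀ a ∉ I, (fibre I c (c a)).card = d := by
  classical
  have h1 : d + 1 ≤ I.card := hg.lt_card hd hnd
  have h2 := hg.2.card_add_le
  rw [zeroBlock_ofMap] at h2
  have h3 : I.card = d + 1 := by omega
  refine ⟨h3, ?_⟩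
  by_contra! hcon
  obtain ⟨a, ha, hne⟩ := hcon
  have h4 := card_eq_sum_fibre I c
  have hle : ∀ i ∈ Iᶜ.image c, d ≤ (fibre I c i).card := fun i hi =>
    Nat.le_of_dvd (card_pos.2 (fibre_nonempty hi)) (isBalanced_ofMap.1 hg.2 i).1
  have hmem : c a ∈ Iᶜ.image c := mem_image_of_mem c (mem_compl.2 ha)
  have h5 : ∑ i ∈ Iᶜ.image c, d < ∑ i ∈ Iᶜ.image c, (fibre I c i).card :=
    sum_lt_sum hle ⟨c a, hmem, lt_of_le_of_ne (hle _ hmem) (Ne.symm hne)⟩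
  rw [sum_const, smul_eq_mul, mul_comm, ← numBlocks_ofMap I c γ] at h5
  omega

/-- In an atom that cannot be improved, the nonzero blocks are determined by the zero block. -/
theorem exists_class_eq_iff [NeZero k] (hkd : k ∣ d) (hd : 2 ≤ d) (hnd : n ≡ 1 [MOD d])
    (y : Dowling n r) (I : Finset (Fin n)) :
    ∃ Q : Fin n → Fin n → Prop, ∀ {κ : Type} (c : Fin n → κ) (γ : Fin n → ZMod r),
      IsGood d hkr (ofMap I c γ) → d * (ofMap I c γ).numBlocks + d + 1 = n → ofMap I c γ ≤ y →
      ¬ Improvable enc d hkr y (ofMap I c γ) → ∀ u ∉ I, ∀ v ∉ I, c u = c v ↔ Q u v := by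
  classical
  obtain ⟨J, e, δ, rfl⟩ := exists_ofMap y
  set φ := ZMod.castHom hkr (ZMod k) with hφ
  -- `Y` records the block of `y`, with `none` for its zero block, and `G` also the colour in a
  -- nonzero block. Elements of one `G`-class may be exchanged; a block of the atom meets such a
  -- class in d elements inside the zero block of `y`, and in d/k elements otherwise.
  set G : Fin n → Option (Finset (Fin n) × ZMod k) :=
    fun a => if a ∈ J then none else some (e a, φ (δ a)) with hG
  set Y : Fin n → Option (Finset (Fin n)) := fun a => if a ∈ J then none else some (e a) with hY
  set N : Option (Finset (Fin n)) → ℕ := fun o => if o = none then d else d / k with hN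
  refine ⟨fun u v => Y u = Y v ∧ (Iᶜ.filter fun b => G b = G u ∧ b < u).card / N (Y u) =
      (Iᶜ.filter fun b => G b = G v ∧ b < v).card / N (Y v), ?_⟩
  intro κ c γ hg hm hle himp u hu v hv
  have hfib := (atom_card hg hd hnd hm).2
  have hbal := isBalanced_ofMap.1 hg.2
  have hNpos : ∀ o, 0 < N o := by
    intro o
    simp only [hN]
    split_ifs
    · omega
    · exact Nat.div_pos (Nat.le_of_dvd (by omega) hkd) (NeZero.pos k)
  have hGY : ∀ a b, G a = G b → Y a = Y b := by
    intro a b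
    by_cases ha : a ∈ J <;> by_cases hb : b ∈ J <;> simp [hG, hY, ha, hb]
    exact fun h _ => h
  have hcJ : ∀ a ∉ I, ∀ b ∉ I, c a = c b → (a ∈ J ↔ b ∈ J) := fun a ha b hb hab =>
    mem_zeroBlock_iff_of_le hle ha hb hab
  have hce : ∀ a ∉ I, ∀ b ∉ I, c a = c b → a ∉ J → e a = e b ∧ δ b - δ a = γ b - γ a := by
    intro a ha b hb hab haJ
    rcases (ofMap_le_ofMap_iff.1 hle).2 a ha b hb hab with h | h
    · exact absurd h.1 haJ
    · exact h.2.2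
  refine class_eq_iff (S := fun i => ∑ a ∈ fibre I c i, ((a : ℕ) : ℤ)) hNpos hGY ?_ ?_ ?_
    (mem_compl.2 hu) (mem_compl.2 hv)
  · intro a ha b hb hab
    rw [mem_compl] at ha hb
    have h1 := hcJ a ha b hb hab
    by_cases haJ : a ∈ J
    · simp [hY, haJ, h1.1 haJ]
    · simp [hY, haJ, mt h1.2 haJ, (hce a ha b hb hab haJ).1]
  · intro u hu w hw hwu
    rw [mem_compl] at hu hw
    by_cases huJ : u ∈ J
    · have hwJ : w ∈ J := by
        by_contra hwJ
        simp [hY, huJ, hwJ] at hwu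
      have hGu : G u = none := by simp [hG, huJ]
      have hNu : N (Y u) = d := by simp [hN, hY, huJ]
      rw [hNu, hGu, ← hfib w hw]
      congr 1
      ext b
      rw [mem_filter, mem_fibre, mem_compl]
      refine and_congr_right fun hb => and_iff_right_of_imp fun hbw => ?_
      simp [hG, (hcJ b hb w hw hbw).2 hwJ]
    · have hwJ : w ∉ J := by
        intro hwJ
        simp [hY, huJ, hwJ] at hwu
      have hewu : e w = e u := by simpa [hY, huJ, hwJ] using hwu
      have hNu : N (Y u) = d / k := by simp [hN, hY, huJ]
      have hset : (Iᶜ.filter fun b => G b = G u ∧ c b = c w) =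
          (fibre I c (c w)).filter fun b => φ (γ b) = φ (δ u) - φ (δ w) + φ (γ w) := by
        ext b
        rw [mem_filter, mem_filter, mem_fibre, mem_compl, and_assoc, and_comm (a := G b = G u)]
        refine and_congr_right fun hb => and_congr_right fun hbw => ?_
        have hbJ : b ∉ J := fun h => hwJ ((hcJ b hb w hw hbw).1 h)
        obtain ⟨h1, h2⟩ := hce w hw b hb hbw.symm hwJ
        have h3 : φ (δ b) - φ (δ w) = φ (γ b) - φ (γ w) := by rw [← map_sub, h2, map_sub]
        simp only [hG, huJ, hbJ, if_false, Option.some.injEq, Prod.mk.injEq, ← h1, hewu, true_and]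
        rw [sub_eq_iff_eq_add] at h3
        rw [h3]
        constructor
        · intro h
          linear_combination h
        · intro h
          linear_combination h
      rw [hNu, hset]
      refine Nat.eq_div_of_mul_eq_right (NeZero.ne k) ?_
      rw [← hfib w hw]
      exact hbal.card_filter_mul (c w) _
  · intro u hu v hv huv hcuv hlt
    rw [mem_compl] at hu hv
    by_contra hSle
    rw [not_lt] at hSle
    refine himp ?_
    by_cases huJ : u ∈ J
    · have hvJ : v ∈ J := by
        by_contra hvJ
        simp [hG, huJ, hvJ] at huv
      -- Inside the zero block of `y` every label difference is allowed; 0 has the required colour.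
      exact improvable_of_swap hg hle hu hv hcuv hlt hSle (g := 0) (Or.inl ⟨hvJ, huJ⟩) (map_zero _)
    · have hvJ : v ∉ J := by
        intro hvJ
        simp [hG, huJ, hvJ] at huv
      have huv' : e u = e v ∧ φ (δ u) = φ (δ v) := by
        simpa only [hG, huJ, hvJ, if_false, Option.some.injEq, Prod.mk.injEq] using huv
      refine improvable_of_swap hg hle hu hv hcuv hlt hSle (g := δ u - δ v)
        (Or.inr (rel_ofMap.2 ⟨hvJ, huJ, huv'.1.symm, (add_sub_cancel _ _).symm⟩)) ?_
      rw [map_sub, sub_eq_zero]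
      exact huv'.2

/-- Of any two atoms below `y`, one can be improved. -/
theorem improvable_or [NeZero k] (hkd : k ∣ d) (hd : 2 ≤ d) (hnd : n ≡ 1 [MOD d])
    (henc : Function.Injective enc) {a a' y : Dowling n r} (ha : IsGood d hkr a)
    (ha' : IsGood d hkr a') (hm : d * a.numBlocks + d + 1 = n)
    (hm' : d * a'.numBlocks + d + 1 = n) (hay : a ≤ y) (hay' : a' ≤ y) (hne : a ≠ a') :
    Improvable enc d hkr y a ∨ Improvable enc d hkr y a' := by
  by_contra! hcon
  obtain ⟨himp, himp'⟩ := hcon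
  obtain ⟨I, c, γ, rfl⟩ := exists_ofMap a
  obtain ⟨I', c', γ', rfl⟩ := exists_ofMap a'
  -- The zero blocks have equal size. If they differ, pick one element of each set difference: the
  -- atom whose zero block contains the larger one is improvable.
  have hI : I = I' := by
    have hcard := (atom_card ha hd hnd hm).1
    have hcard' := (atom_card ha' hd hnd hm').1
    by_contra hII
    have h1 : ¬ I' ⊆ I := fun h => hII (eq_of_subset_of_card_le h (by omega)).symm
    have h2 : ¬ I ⊆ I' := fun h => hII (eq_of_subset_of_card_le h (by omega))
    obtain ⟨e, he', he⟩ := not_subset.1 h1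
    obtain ⟨f, hf, hf'⟩ := not_subset.1 h2
    rcases lt_trichotomy e f with h | rfl | h
    · exact himp (improvable_of_zero ha hay he hf h (zeroBlock_mono hay' he'))
    · exact he hf
    · exact himp' (improvable_of_zero ha' hay' hf' he' h (zeroBlock_mono hay hf))
  subst hI
  obtain ⟨Q, hQ⟩ := exists_class_eq_iff (enc := enc) (hkr := hkr) hkd hd hnd y I
  have hcc : ∀ u ∉ I, ∀ v ∉ I, (c' u = c' v ↔ c u = c v) := fun u hu v hv =>
    (hQ c' γ' ha' hm' hay' himp' u hu v hv).trans (hQ c γ ha hm hay himp u hu v hv).symm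
  rw [ofMap_congr (c' := c) (γ' := γ') hcc fun _ _ _ _ _ => rfl] at ha' hay' himp' hne
  have hdiff : ∃ u ∉ I, ∃ v ∉ I, c u = c v ∧ γ v - γ u ≠ γ' v - γ' u := by
    by_contra! h
    exact hne (ofMap_congr (fun _ _ _ _ => Iff.rfl) h)
  obtain ⟨u, hu, v, hv, huv, hγ⟩ := hdiff
  -- A nonzero block of `y` prescribes the label differences of everything below it, so the two
  -- atoms can disagree only inside the zero block.
  have huy : u ∈ y.zeroBlock := by
    by_contra huy
    rcases (ofMap_le_iff.1 hay).2 u hu v hv huv with h | h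
    · exact huy h.1
    rcases (ofMap_le_iff.1 hay').2 u hu v hv huv with h' | h'
    · exact huy h'.1
    exact hγ (h.eq h')
  obtain ⟨w, hw, hwmin⟩ := exists_min_image (fibre I c (c u)) id ⟨u, mem_fibre.2 ⟨hu, rfl⟩⟩
  rw [mem_fibre] at hw
  have hwy := (mem_zeroBlock_iff_of_le hay hw.1 hu hw.2).2 huy
  have hmin : ∀ v ∈ fibre I c (c w), w ≤ v := by
    rw [hw.2]
    exact hwmin
  have hrow : (ofMap I c γ).Rel w ≠ (ofMap I c γ').Rel w := by
    intro h
    have key : ∀ b ∉ I, c w = c b → γ b - γ w = γ' b - γ' w := by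
      intro b hb hwb
      have h1 : (ofMap I c γ).Rel w b (γ b - γ w) :=
        rel_ofMap.2 ⟨hw.1, hb, hwb, (add_sub_cancel _ _).symm⟩
      rw [h] at h1
      rw [(rel_ofMap.1 h1).2.2.2, add_sub_cancel_left]
    have h1 := key u hu hw.2
    have h2 := key v hv (hw.2.trans huv)
    apply hγ
    linear_combination h2 - h1
  rcases lt_or_gt_of_ne (henc.ne hrow) with h | h
  · exact himp' (improvable_of_label ha' ha hay' hw.1 hwy hmin h)
  · exact himp (improvable_of_label ha ha' hay hw.1 hwy hmin h)

end Dowling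

/-! ### Rank, joins and the recursive atom ordering of the restricted poset -/

namespace Dowling

variable {n r d k : ℕ}

instance [NeZero r] : Finite (Dowling n r) :=
  Finite.of_injective (fun x : Dowling n r => {e | x.Holds e}) fun _ _ h =>
    ext_holds fun e => Set.ext_iff.1 h e

open Classical in
/-- The rank function of `Q_n(r,d,k,{1})`. -/
noncomputable def rank (x : restricted n r d k {1}) : ℤ :=
  if x.1 = zeroHat n r then 0 else ((n / d : ℕ) : ℤ) - (x.1.numBlocks : ℤ)

theorem eq_mul_div_add_one (hn : 2 ≤ n) (hd : 2 ≤ d) (hnd : n ≡ 1 [MOD d]) :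
    n = d * (n / d) + 1 ∧ 1 ≤ n / d := by
  have h1 : n % d = 1 := by
    rw [hnd]
    exact Nat.mod_eq_of_lt (by omega)
  have h2 := Nat.div_add_mod n d
  refine ⟨by omega, ?_⟩
  by_contra! h
  rw [Nat.lt_one_iff.1 h] at h2
  omega

theorem IsGood.ne_zeroHat {hkr : k ∣ r} {x : Dowling n r} (h : IsGood d hkr x) (hd : 2 ≤ d)
    (hnd : n ≡ 1 [MOD d]) : x ≠ zeroHat n r := by
  rintro rfl
  have := h.lt_card hd hnd
  simp [zeroBlock_zeroHat] at this

theorem lt_of_ne_zeroHat {x : Dowling n r} (h : x ≠ zeroHat n r) : zeroHat n r < x :=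
  lt_of_le_of_ne (zeroHat_le x) h.symm

theorem ne_zeroHat_of_lt {x y : Dowling n r} (h : x < y) : y ≠ zeroHat n r := by
  rintro rfl
  exact absurd (zeroHat_le x) h.not_ge

/-- For d = 1 the formula is also right at 0̂, which has n blocks. -/
theorem rank_eq (x : restricted n r d k {1}) (hx : d = 1 ∨ x.1 ≠ zeroHat n r) :
    rank x = ((n / d : ℕ) : ℤ) - (x.1.numBlocks : ℤ) := by
  unfold rank
  split_ifs with h
  · rcases hx with rfl | hx
    · rw [h, numBlocks_zeroHat, Nat.div_one, sub_self]
    · exact absurd h hx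
  · rfl

section Restricted

variable [NeZero r] [NeZero k]

theorem isGood_of_ne (hkr : k ∣ r) (x : restricted n r d k {1}) (hx : x.1 ≠ zeroHat n r) :
    IsGood d hkr x.1 :=
  ((mem_restricted_iff hkr).1 x.2).resolve_left hx

theorem mem_restricted_of_isGood {hkr : k ∣ r} {x : Dowling n r} (h : IsGood d hkr x) :
    x ∈ restricted n r d k {1} :=
  (mem_restricted_iff hkr).2 (Or.inr h)

theorem card_ne_one (hkr : k ∣ r) (x : restricted n r d k {1}) : x.1.zeroBlock.card ≠ 1 := by
  rcases (mem_restricted_iff hkr).1 x.2 with h | h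
  · rw [h, zeroBlock_zeroHat]
    simp
  · exact h.1

theorem numBlocks_lt (hn : 2 ≤ n) (hd : 1 ≤ d) (hkr : k ∣ r) (hnd : n ≡ 1 [MOD d])
    (x : restricted n r d k {1}) (hx : x.1 ≠ zeroHat n r) : x.1.numBlocks + 1 ≤ n / d := by
  rcases hd.eq_or_lt with rfl | hd
  · have := numBlocks_lt_of_lt (lt_of_ne_zeroHat hx)
    rw [numBlocks_zeroHat] at this
    rw [Nat.div_one]
    omega
  · have hg := isGood_of_ne hkr x hx
    have h1 := hg.lt_card hd hnd
    have h2 := hg.2.card_add_le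
    have h3 := (eq_mul_div_add_one hn hd hnd).1
    refine Nat.le_of_mul_le_mul_left (c := d) ?_ (by omega)
    rw [mul_add, mul_one]
    omega

theorem rank_strictMono (hn : 2 ≤ n) (hd : 1 ≤ d) (hkr : k ∣ r) (hnd : n ≡ 1 [MOD d]) :
    StrictMono (rank : restricted n r d k {1} → ℤ) := by
  intro x y hxy
  have hy : y.1 ≠ zeroHat n r := ne_zeroHat_of_lt (Subtype.coe_lt_coe.2 hxy)
  rw [rank_eq y (Or.inr hy)]
  by_cases hx : x.1 = zeroHat n r
  · have := numBlocks_lt hn hd hkr hnd y hy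
    rw [rank, if_pos hx]
    omega
  · rw [rank_eq x (Or.inr hx)]
    have := numBlocks_lt_of_lt (Subtype.coe_lt_coe.2 hxy)
    omega

/-- For d = 1 a single merge avoiding singleton zero blocks. For d ≥ 2, from 0̂ one splits `y` down
to n/d - 1 blocks; from any other element, every merge stays in the poset. -/
theorem exists_rank_step (hn : 2 ≤ n) (hd : 1 ≤ d) (hkr : k ∣ r) (hkd : k ∣ d)
    (hnd : n ≡ 1 [MOD d]) (x y : restricted n r d k {1}) (hxy : x < y) :
    ∃ z, x < z ∧ z ≤ y ∧ rank z = rank x + 1 := by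
  have hxy' := Subtype.coe_lt_coe.2 hxy
  have hy : y.1 ≠ zeroHat n r := ne_zeroHat_of_lt hxy'
  rcases hd.eq_or_lt with rfl | hd
  · obtain ⟨z, h1, h2, h3, h4⟩ :=
      exists_step_card_ne_one hxy' (card_ne_one hkr x) (card_ne_one hkr y)
    refine ⟨⟨z, mem_restricted_of_isGood (hkr := hkr) ⟨h4, isBalanced_one hkd rfl z⟩⟩, h1, h2, ?_⟩
    rw [rank_eq _ (Or.inl rfl), rank_eq _ (Or.inl rfl)]
    simp only
    omega
  by_cases hx : x.1 = zeroHat n r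
  · obtain ⟨h1, h2⟩ := eq_mul_div_add_one hn hd hnd
    have hmul : d * (n / d - 1) + d = d * (n / d) := by
      rw [← Nat.mul_succ, Nat.succ_eq_add_one, Nat.sub_add_cancel h2]
    have h3 := numBlocks_lt hn hd.le hkr hnd y hy
    obtain ⟨z, k1, k2, k3⟩ := exists_le_of_isGood (m := n / d - 1) hkd hd (isGood_of_ne hkr y hy)
      (by omega) (by omega)
    have hz := k1.ne_zeroHat hd hnd
    refine ⟨⟨z, mem_restricted_of_isGood k1⟩, ?_, k2, ?_⟩
    · rw [← Subtype.coe_lt_coe, hx]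
      exact lt_of_ne_zeroHat hz
    · rw [rank_eq _ (Or.inr hz), rank, if_pos hx]
      simp only
      omega
  · obtain ⟨z, h1, h2, h3⟩ := exists_step hxy'
    have hz := (isGood_of_ne hkr x hx).of_le hd hnd h1.le
    refine ⟨⟨z, mem_restricted_of_isGood hz⟩, h1, h2, ?_⟩
    rw [rank_eq _ (Or.inr (hz.ne_zeroHat hd hnd)), rank_eq _ (Or.inr hx)]
    simp only
    omega

/-- Joins are thus inherited from the Dowling lattice, for d ≥ 2 because the elements other than 0̂
form an upper set. -/
theorem isLUB_mem_restricted (hd : 1 ≤ d) (hkr : k ∣ r) (hkd : k ∣ d) (hnd : n ≡ 1 [MOD d])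
    (x y : restricted n r d k {1}) {z : Dowling n r} (hz : IsLUB {x.1, y.1} z) :
    z ∈ restricted n r d k {1} := by
  rcases hd.eq_or_lt with rfl | hd
  · exact mem_restricted_of_isGood (hkr := hkr)
      ⟨card_zeroBlock_ne_one_of_isLUB hz (card_ne_one hkr x) (card_ne_one hkr y),
        isBalanced_one hkd rfl z⟩
  by_cases hx : x.1 = zeroHat n r
  · have : IsLUB {x.1, y.1} y.1 := by
      rw [hx]
      refine ⟨?_, fun w hw => hw (by simp)⟩
      rintro w (rfl | rfl)
      · exact zeroHat_le _
      · exact le_rfl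
    rw [hz.unique this]
    exact y.2
  · exact mem_restricted_of_isGood ((isGood_of_ne hkr x hx).of_le hd hnd (hz.1 (by simp)))

theorem exists_isLUB_restricted (hd : 1 ≤ d) (hkr : k ∣ r) (hkd : k ∣ d) (hnd : n ≡ 1 [MOD d])
    (x y : restricted n r d k {1}) : ∃ z, IsLUB {x, y} z := by
  obtain ⟨z, hz⟩ := exists_isLUB x.1 y.1
  refine ⟨⟨z, isLUB_mem_restricted hd hkr hkd hnd x y hz⟩, ?_, fun w hw => hz.2 ?_⟩
  · rintro w (rfl | rfl)
    · exact hz.1 (by simp)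
    · exact hz.1 (by simp)
  · rintro v (rfl | rfl)
    · exact hw (by simp)
    · exact hw (by simp)

theorem zeroHat_mem_restricted (hkr : k ∣ r) : zeroHat n r ∈ restricted n r d k {1} :=
  (mem_restricted_iff hkr).2 (Or.inl rfl)

theorem oneHat_mem_restricted (hn : 2 ≤ n) (hkr : k ∣ r) :
    oneHat n r ∈ restricted n r d k {1} := by
  refine mem_restricted_of_isGood (hkr := hkr) ⟨?_, isBalanced_ofMap.2 fun i => ?_⟩
  · rw [zeroBlock_oneHat, card_univ, Fintype.card_fin]
    omega
  · have : fibre (univ : Finset (Fin n)) (fun _ => ()) i = ∅ := by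
      ext a
      simp
    rw [this]
    simp only [filter_empty, card_empty, dvd_zero, implies_true, and_self]

/-- The hypothesis on `x` makes each cover of `x` in the subposet lose exactly one block, so the
semimodularity of the Dowling lattice applies. From 0̂ with d ≥ 2 this fails, as an atom needs many
merges. -/
theorem exists_covBy_of_covBy (hn : 2 ≤ n) (hd : 1 ≤ d) (hkr : k ∣ r) (hkd : k ∣ d)
    (hnd : n ≡ 1 [MOD d]) (x u v y : restricted n r d k {1}) (hx : d = 1 ∨ x.1 ≠ zeroHat n r)
    (hu : x ⋖ u) (hv : x ⋖ v) (huv : u ≠ v) (huy : u ≤ y) (hvy : v ≤ y) :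
    ∃ w, u ⋖ w ∧ v ⋖ w ∧ w ≤ y := by
  have hstep := exists_rank_step (k := k) hn hd hkr hkd hnd
  have hmono := rank_strictMono (k := k) hn hd hkr hnd
  have hnum : ∀ u, x ⋖ u → u.1.numBlocks + 1 = x.1.numBlocks := by
    intro u hu
    have h := rank_eq_of_covBy hstep hu
    rw [rank_eq u (Or.inr (ne_zeroHat_of_lt (Subtype.coe_lt_coe.2 hu.lt))), rank_eq x hx] at h
    omega
  obtain ⟨w, h1, h2, h3, h4⟩ := exists_isLUB_of_steps (Subtype.coe_lt_coe.2 hu.lt).le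
    (Subtype.coe_lt_coe.2 hv.lt) (hnum u hu) (hnum v hv) fun h => huv (Subtype.ext h)
  have hw := isLUB_mem_restricted hd hkr hkd hnd u v h1
  have hcov : ∀ u : restricted n r d k {1}, x ⋖ u → u.1 < w →
      u ⋖ (⟨w, hw⟩ : restricted n r d k {1}) := by
    intro u' hu' hlt
    refine covBy_of_rank_eq hmono hlt ?_
    rw [rank_eq u' (Or.inr (ne_zeroHat_of_lt (Subtype.coe_lt_coe.2 hu'.lt))),
      rank_eq _ (Or.inr (ne_zeroHat_of_lt hlt))]
    have h5 := hnum u' hu'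
    have h6 := hnum u hu
    simp only
    omega
  refine ⟨⟨w, hw⟩, hcov u hu h2, hcov v hv h3, h1.2 ?_⟩
  rintro t (rfl | rfl)
  · exact huy
  · exact hvy

theorem admitsRecAtomOrdering_restricted (hn : 2 ≤ n) (hd : 1 ≤ d) (hkr : k ∣ r) (hkd : k ∣ d)
    (hnd : n ≡ 1 [MOD d]) : AdmitsRecAtomOrdering (restricted n r d k {1}) := by
  set b : restricted n r d k {1} := ⟨zeroHat n r, zeroHat_mem_restricted hkr⟩ with hb
  set t : restricted n r d k {1} := ⟨oneHat n r, oneHat_mem_restricted hn hkr⟩ with ht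
  have hbt : b < t := by
    refine lt_of_ne_zeroHat fun h => ?_
    have := congrArg numBlocks h
    rw [numBlocks_zeroHat, numBlocks_oneHat] at this
    omega
  refine ⟨b, t, fun x => zeroHat_le x.1, fun x => le_oneHat x.1, ?_⟩
  have hrec : ∀ x : restricted n r d k {1}, (d = 1 ∨ x.1 ≠ zeroHat n r) → x < t →
      ∀ l : List (restricted n r d k {1}), l.Nodup → (∀ a, a ∈ l ↔ x ⋖ a ∧ a ≤ t) →
        IsRecAtomOrdering t x l := by
    intro x hx hlt l hl hmem
    refine isRecAtomOrdering_of_semimodular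
      (S := fun x : restricted n r d k {1} => d = 1 ∨ x.1 ≠ zeroHat n r) ?_
      (exists_covBy_of_covBy hn hd hkr hkd hnd) hx hlt hl hmem
    rintro x y (h | h) hxy
    · exact Or.inl h
    · exact Or.inr (ne_zeroHat_of_lt ((lt_of_ne_zeroHat h).trans_le hxy))
  rcases hd.eq_or_lt with rfl | hd
  · refine ⟨(Set.toFinite {a | b ⋖ a ∧ a ≤ t}).toFinset.toList,
      hrec b (Or.inl rfl) hbt _ (nodup_toList _) fun a => ?_⟩
    rw [mem_toList, Set.Finite.mem_toFinset, Set.mem_ofPred_eq]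
  obtain ⟨enc, henc⟩ := exists_injective_nat (Fin n → ZMod r → Prop)
  have hstep := exists_rank_step (k := k) hn hd.le hkr hkd hnd
  have hmono := rank_strictMono (k := k) hn hd.le hkr hnd
  have hb0 : rank b = 0 := if_pos rfl
  obtain ⟨hn1, hn2⟩ := eq_mul_div_add_one hn hd hnd
  have hatom : ∀ a : restricted n r d k {1}, b ⋖ a → a.1 ≠ zeroHat n r ∧
      a.1.numBlocks + 1 = n / d := by
    intro a ha
    have hne : a.1 ≠ zeroHat n r := ne_zeroHat_of_lt (Subtype.coe_lt_coe.2 ha.lt)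
    have h := rank_eq_of_covBy hstep ha
    rw [hb0, rank_eq a (Or.inr hne)] at h
    exact ⟨hne, by omega⟩
  -- As many blocks as an atom makes a good element an atom, and one merge above an atom is a cover.
  have himp : ∀ a y : restricted n r d k {1}, b ⋖ a → Improvable enc d hkr y.1 a.1 →
      ∃ a', b ⋖ a' ∧ key enc a'.1 < key enc a.1 ∧ ∃ z, a ⋖ z ∧ a' < z ∧ z ≤ y := by
    rintro a y ha ⟨a', z, h1, h2, h3, h4, h5, h6, h7⟩
    obtain ⟨hane, hanum⟩ := hatom a ha
    have hz := (isGood_of_ne hkr a hane).of_le hd hnd h4.le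
    have ha' := h1.ne_zeroHat hd hnd
    refine ⟨⟨a', mem_restricted_of_isGood h1⟩, ?_, h3, ⟨z, mem_restricted_of_isGood hz⟩, ?_, ?_, h7⟩
    · refine covBy_of_rank_eq hmono (lt_of_ne_zeroHat ha') ?_
      rw [hb0, rank_eq _ (Or.inr ha')]
      simp only
      omega
    · refine covBy_of_rank_eq hmono h4 ?_
      rw [rank_eq _ (Or.inr hane), rank_eq _ (Or.inr (hz.ne_zeroHat hd hnd))]
      simp only
      omega
    · refine lt_of_le_of_ne (show a' ≤ z from h6) fun h => ?_
      have := congrArg (fun x : restricted n r d k {1} => x.1.numBlocks) h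
      simp only at this
      omega
  refine exists_isRecAtomOrdering_of_key hbt (fun x : restricted n r d k {1} => key enc x.1) ?_
    fun a ha => hrec a (Or.inr (hatom a ha).1)
  intro a a' y ha ha' hne hay hay'
  have hnum : ∀ a : restricted n r d k {1}, b ⋖ a → d * a.1.numBlocks + d + 1 = n := by
    intro a ha
    have h : d * (a.1.numBlocks + 1) = d * (n / d) := by rw [(hatom a ha).2]
    rw [mul_add, mul_one] at h
    omega
  exact (improvable_or hkd hd hnd henc (isGood_of_ne hkr a (hatom a ha).1)
    (isGood_of_ne hkr a' (hatom a' ha').1) (hnum a ha) (hnum a' ha')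
    (Subtype.coe_le_coe.2 hay.le) (Subtype.coe_le_coe.2 hay'.le)
    fun h => hne (Subtype.ext h)).imp (himp a y ha) (himp a' y ha')

end Restricted

end Dowling

theorem mainTheorem5 (n r d k : ℕ) (hn : 2 ≤ n) (hr : 1 ≤ r) (hd : 1 ≤ d)
    (hkr : k ∣ r) (hkd : k ∣ d) (hnd : n ≡ 1 [MOD d]) :
    IsLatticeOrder (Dowling.restricted n r d k {1}) ∧
    IsPurePoset (Dowling.restricted n r d k {1}) ∧
    (∃ ρ : Dowling.restricted n r d k {1} → ℤ, IsRankFunction ρ ∧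
      ∀ x, (x.1 = Dowling.zeroHat n r → ρ x = 0) ∧
        (x.1 ≠ Dowling.zeroHat n r → ρ x = ((n / d : ℕ) : ℤ) - (x.1.numBlocks : ℤ))) ∧
    AdmitsRecAtomOrdering (Dowling.restricted n r d k {1}) := by
  have : NeZero r := ⟨by omega⟩
  have : NeZero k := ⟨by
    rintro rfl
    have := Nat.eq_zero_of_zero_dvd hkr
    omega⟩
  have hstep := Dowling.exists_rank_step (k := k) hn hd hkr hkd hnd
  have hbot : IsBot (⟨Dowling.zeroHat n r, Dowling.zeroHat_mem_restricted hkr⟩ :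
    Dowling.restricted n r d k {1}) := fun x => Dowling.zeroHat_le x.1
  have htop : IsTop (⟨Dowling.oneHat n r, Dowling.oneHat_mem_restricted hn hkr⟩ :
    Dowling.restricted n r d k {1}) := fun x => Dowling.le_oneHat x.1
  refine ⟨isLatticeOrder_of_isLUB hbot (Dowling.exists_isLUB_restricted hd hkr hkd hnd),
    isPurePoset_of_step hbot htop (if_pos rfl) (Dowling.rank_strictMono hn hd hkr hnd) hstep,
    ⟨Dowling.rank, isRankFunction_of_step hbot (if_pos rfl) hstep, fun x =>
      ⟨fun h => if_pos h, fun h => if_neg h⟩⟩,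
    Dowling.admitsRecAtomOrdering_restricted hn hd hkr hkd hnd⟩
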